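/- Let $(M,d)$ be a compact metric space with a Borel probability measure $\mu$ of full support, let $\Omega=M^{\mathbb N}$ carry the metric $d_\Omega(x,y)=\sum_{n\ge 1}2^{-n}d(x_n,y_n)$ and the left shift $\sigma$, and let $0<\gamma\le 1$. Let $C^\gamma(\Omega)$ be the Banach space of real $\gamma$-Hölder functions on $\Omega$ with the norm $\|f\|_\gamma=\sup_\Omega|f|+\sup_{x\ne y}|f(x)-f(y)|/d_\Omega(x,y)^\gamma$. For $f\in C^\gamma(\Omega)$ let $\mathscr L_f$ be the Ruelle operator on $C^\gamma(\Omega)$, $$\mathscr L_f\varphi(x)=\int_M e^{f(ax)}\varphi(ax)\,d\mu(a),\qquad ax=(a,x_1,x_2,\dots).$$ 1. For every $f\in C^\gamma(\Omega)$ the operator $\mathscr L_f$ (on the complexification of $C^\gamma(\Omega)$) has a (necessarily unique) main eigenvalue $\lambda_f$: $\lambda_f>0$ is an eigenvalue, isolated in the spectrum and simple (its spectral projector has one-dimensional image), and the remainder of the spectrum is contained in a disc centred at $0$ of radius strictly smaller than $\lambda_f$. 2. Define the entropy of a $\sigma$-invariant Borel probability measure $\nu$ on $\Omega$ and the pressure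 of $f\in C^\gamma(\Omega)$ by $$h(\nu)=\inf_{g\in C^\gamma(\Omega)}\Big\{-\int_\Omega g\,d\nu+\log\lambda_g\Big\}\in[-\infty,\infty),\qquad P(f)=\sup_{\nu\ \sigma\text{-invariant}}\Big\{h(\nu)+\int_\Omega f\,d\nu\Big\}.$$ Then $P(f)=\log\lambda_f$ for every $f\in C^\gamma(\Omega)$; in particular $P(f)$ is finite. 3. The function $P:C^\gamma(\Omega)\to\mathbb R$ is real analytic on $C^\gamma(\Omega)$, that is, around every $f$ it is given by a convergent power series in the Banach space $C^\gamma(\Omega)$. -/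

import Mathlib

open MeasureTheory Set Filter Topology
open scoped NNReal ENNReal

noncomputable section SequenceSpace

/-! ## The space `Ω = M^ℕ` of sequences (coordinates indexed from `0`) -/

variable {M : Type*} [MetricSpace M] [CompactSpace M]

theorem seqDist_summable (x y : ℕ → M) :
    Summable fun n : ℕ => (1 / 2 : ℝ) ^ (n + 1) * dist (x n) (y n) := by
  have hs : Summable fun n : ℕ => (1 / 2 : ℝ) ^ (n + 1) * Metric.diam (univ : Set M) :=
    (((summable_nat_add_iff 1).2 summable_geometric_two)).mul_right _
  refine Summable.of_nonneg_of_le (fun n => by positivity) (fun n => ?_) hs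
  gcongr
  exact Metric.dist_le_diam_of_mem isCompact_univ.isBounded (mem_univ _) (mem_univ _)

theorem seqDist_term_le (x y : ℕ → M) (n : ℕ) :
    (1 / 2 : ℝ) ^ (n + 1) * dist (x n) (y n)
      ≤ ∑' k : ℕ, (1 / 2 : ℝ) ^ (k + 1) * dist (x k) (y k) :=
  (seqDist_summable x y).le_tsum n (fun k _ => by positivity)

theorem seqDist_continuous :
    Continuous fun p : (ℕ → M) × (ℕ → M) =>
      ∑' n : ℕ, (1 / 2 : ℝ) ^ (n + 1) * dist (p.1 n) (p.2 n) := by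
  have hs : Summable fun n : ℕ => (1 / 2 : ℝ) ^ (n + 1) * Metric.diam (univ : Set M) :=
    (((summable_nat_add_iff 1).2 summable_geometric_two)).mul_right _
  refine continuous_tsum (fun n => by fun_prop) hs (fun n p => ?_)
  rw [Real.norm_of_nonneg (by positivity)]
  gcongr
  exact Metric.dist_le_diam_of_mem isCompact_univ.isBounded (mem_univ _) (mem_univ _)

/-- The metric `d_Ω(x, y) = ∑_{n ≥ 1} 2⁻ⁿ d(xₙ, yₙ)` on `Ω`. It induces the product topology
(and the product uniformity, which is kept definitionally). -/
instance seqMetricSpace : MetricSpace (ℕ → M) where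
  dist x y := ∑' n : ℕ, (1 / 2 : ℝ) ^ (n + 1) * dist (x n) (y n)
  dist_self x := by simp
  dist_comm x y := by simp only [dist_comm]
  dist_triangle x y z := by
    rw [← (seqDist_summable x y).tsum_add (seqDist_summable y z)]
    refine (seqDist_summable x z).tsum_le_tsum (fun n => ?_)
      ((seqDist_summable x y).add (seqDist_summable y z))
    rw [← mul_add]
    gcongr
    exact dist_triangle _ _ _
  eq_of_dist_eq_zero := by
    intro x y h
    funext n
    have h1 := seqDist_term_le x y n
    have h2 : (∑' k : ℕ, (1 / 2 : ℝ) ^ (k + 1) * dist (x k) (y k)) = 0 := h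
    rw [h2] at h1
    have h3 : (0 : ℝ) < (1 / 2 : ℝ) ^ (n + 1) := by positivity
    exact dist_le_zero.1 (by nlinarith [dist_nonneg (x := x n) (y := y n)])
  toUniformSpace := Pi.uniformSpace _
  uniformity_dist := by
    apply le_antisymm
    · refine le_iInf₂ fun ε hε => le_principal_iff.2 ?_
      rw [← nhdsSet_diagonal_eq_uniformity]
      refine (isOpen_lt seqDist_continuous continuous_const).mem_nhdsSet.2 ?_
      rintro ⟨x, y⟩ hxy
      obtain rfl : x = y := hxy
      simpa using hε
    · rw [Pi.uniformity]
      refine le_iInf fun i => ?_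
      rw [Metric.uniformity_basis_dist.comap _ |>.ge_iff]
      intro ε hε
      have hp : (0 : ℝ) < (1 / 2 : ℝ) ^ (i + 1) := by positivity
      refine mem_iInf_of_mem ((1 / 2 : ℝ) ^ (i + 1) * ε) (mem_iInf_of_mem (by positivity) ?_)
      rintro ⟨x, y⟩ hxy
      have h1 := (seqDist_term_le x y i).trans_lt hxy
      exact lt_of_mul_lt_mul_left h1 hp.le

/-- The concatenation `a x = (a, x₁, x₂, …)`. -/
def consSeq {X : Type*} (a : X) (x : ℕ → X) : ℕ → X
  | 0 => a
  | n + 1 => x n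

/-- The left shift `σ (x₁, x₂, …) = (x₂, x₃, …)`. -/
def shiftSeq {X : Type*} (x : ℕ → X) : ℕ → X := fun n => x (n + 1)

theorem continuous_consSeq {X : Type*} [TopologicalSpace X] :
    Continuous fun p : X × (ℕ → X) => consSeq p.1 p.2 := by
  refine continuous_pi fun n => ?_
  cases n with
  | zero => exact continuous_fst
  | succ n => exact (continuous_apply n).comp continuous_snd

theorem dist_consSeq (a : M) (x y : ℕ → M) :
    dist (consSeq a x) (consSeq a y) = (1 / 2 : ℝ) * dist x y := by
  change (∑' n : ℕ, (1 / 2 : ℝ) ^ (n + 1) * dist (consSeq a x n) (consSeq a y n))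
    = (1 / 2 : ℝ) * ∑' n : ℕ, (1 / 2 : ℝ) ^ (n + 1) * dist (x n) (y n)
  rw [(seqDist_summable (consSeq a x) (consSeq a y)).tsum_eq_zero_add, ← tsum_mul_left]
  simp only [consSeq, dist_self, mul_zero, zero_add]
  exact tsum_congr fun n => by ring

end SequenceSpace

noncomputable section HolderFunctions

/-! ## The Banach space `C^γ(Ω)` of `𝕜`-valued Hölder functions (`𝕜 = ℝ` or `ℂ`) -/

variable (M : Type*) [MetricSpace M] [CompactSpace M] (γ : ℝ≥0) (𝕜 : Type*) [RCLike 𝕜]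

/-- The `γ`-Hölder functions as a linear subspace of `C(Ω, 𝕜)`. -/
def holderSubmodule : Submodule 𝕜 C(ℕ → M, 𝕜) where
  carrier := {f | MemHolder γ f}
  add_mem' hf hg := MemHolder.add hf hg
  zero_mem' := memHolder_zero
  smul_mem' _ _ hf := MemHolder.smul hf

/-- The space `C^γ(Ω)`, without the supremum norm that the subspace would inherit. -/
def HolderSpace : Type _ := ↥(holderSubmodule M γ 𝕜)

namespace HolderSpace

instance : AddCommGroup (HolderSpace M γ 𝕜) :=
  inferInstanceAs (AddCommGroup ↥(holderSubmodule M γ 𝕜))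

instance : Module 𝕜 (HolderSpace M γ 𝕜) :=
  inferInstanceAs (Module 𝕜 ↥(holderSubmodule M γ 𝕜))

variable {M γ 𝕜}

/-- The underlying continuous function. -/
def toCont (f : HolderSpace M γ 𝕜) : C(ℕ → M, 𝕜) := Subtype.val f

instance : FunLike (HolderSpace M γ 𝕜) (ℕ → M) 𝕜 where
  coe f := f.toCont
  coe_injective _ _ h := Subtype.ext (DFunLike.coe_injective h)

theorem memHolder (f : HolderSpace M γ 𝕜) : MemHolder γ f := Subtype.property f

@[simp] theorem coe_toCont (f : HolderSpace M γ 𝕜) : ⇑f.toCont = f := rfl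

@[simp] theorem coe_add (f g : HolderSpace M γ 𝕜) : ⇑(f + g) = f + g := rfl

@[simp] theorem coe_smul (c : 𝕜) (f : HolderSpace M γ 𝕜) : ⇑(c • f) = c • ⇑f := rfl

theorem continuous (f : HolderSpace M γ 𝕜) : Continuous f := f.toCont.continuous

/-- `‖f‖_γ = ‖f‖₀ + Hol(f)`; Mathlib's `nnHolderNorm γ f` is the least Hölder constant of `f`,
that is `Hol(f) = sup_{x ≠ y} |f x - f y| / d_Ω(x, y)^γ`. -/
instance : Norm (HolderSpace M γ 𝕜) where
  norm f := ‖f.toCont‖ + nnHolderNorm γ f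

theorem norm_def (f : HolderSpace M γ 𝕜) : ‖f‖ = ‖f.toCont‖ + nnHolderNorm γ f := rfl

theorem normCore : NormedSpace.Core 𝕜 (HolderSpace M γ 𝕜) where
  norm_nonneg f := by rw [norm_def]; positivity
  norm_smul c f := by
    rw [norm_def, norm_def, coe_smul, f.memHolder.nnHolderNorm_smul,
      show (c • f).toCont = c • f.toCont from rfl, norm_smul]
    push_cast
    ring
  norm_triangle f g := by
    have h1 : ‖(f + g).toCont‖ ≤ ‖f.toCont‖ + ‖g.toCont‖ := norm_add_le f.toCont g.toCont
    have h2 : (nnHolderNorm γ (f + g) : ℝ) ≤ nnHolderNorm γ f + nnHolderNorm γ g := by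
      rw [coe_add]
      exact_mod_cast f.memHolder.nnHolderNorm_add_le g.memHolder
    rw [norm_def, norm_def, norm_def]
    linarith
  norm_eq_zero_iff f := by
    constructor
    · intro h
      rw [norm_def] at h
      have h1 : ‖f.toCont‖ = 0 := by
        linarith [norm_nonneg f.toCont, (nnHolderNorm γ f).coe_nonneg]
      exact Subtype.ext (norm_eq_zero.1 h1)
    · rintro rfl
      rw [norm_def]
      have h1 : ‖(0 : HolderSpace M γ 𝕜).toCont‖ = 0 := norm_zero (E := C(ℕ → M, 𝕜))
      have h2 : nnHolderNorm γ (⇑(0 : HolderSpace M γ 𝕜)) = 0 :=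
        nnHolderNorm_const (ℕ → M) γ (0 : 𝕜)
      rw [h1, h2]
      simp

instance : NormedAddCommGroup (HolderSpace M γ 𝕜) := NormedAddCommGroup.ofCore normCore

instance : NormedSpace 𝕜 (HolderSpace M γ 𝕜) := NormedSpace.ofCore normCore

theorem norm_apply_le (f : HolderSpace M γ 𝕜) (x : ℕ → M) : ‖f x‖ ≤ ‖f.toCont‖ :=
  f.toCont.norm_coe_le_norm x

theorem norm_sub_le (f : HolderSpace M γ 𝕜) (x y : ℕ → M) :
    ‖f x - f y‖ ≤ nnHolderNorm γ f * dist x y ^ (γ : ℝ) := by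
  rw [← dist_eq_norm]
  exact f.memHolder.holderWith.dist_le x y

theorem holderWith_of_norm_sub_le {g : (ℕ → M) → 𝕜} {C : ℝ≥0}
    (h : ∀ x y, ‖g x - g y‖ ≤ C * dist x y ^ (γ : ℝ)) : HolderWith C γ g := by
  intro x y
  have h1 := h x y
  rw [← dist_eq_norm] at h1
  rw [edist_dist, edist_dist, ENNReal.ofReal_rpow_of_nonneg dist_nonneg γ.coe_nonneg,
    ← ENNReal.ofReal_coe_nnreal, ← ENNReal.ofReal_mul C.coe_nonneg]
  exact ENNReal.ofReal_le_ofReal h1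

end HolderSpace

end HolderFunctions

noncomputable section RuelleOperator

/-! ## The Ruelle operator -/

variable {M : Type*} [MetricSpace M] [CompactSpace M] {γ : ℝ≥0}

/-- `𝓛_f(φ)(x) = ∫_M e^{f(ax)} φ(ax) dμ(a)`, for a real potential `f` and real or complex `φ`. -/
def ruelleFun (𝕜 : Type*) [RCLike 𝕜] [MeasurableSpace M] (μ : Measure M) (f : HolderSpace M γ ℝ)
    (φ : (ℕ → M) → 𝕜) (x : ℕ → M) : 𝕜 :=
  ∫ a, ((Real.exp (f (consSeq a x)) : ℝ) : 𝕜) * φ (consSeq a x) ∂μ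

variable {𝕜 : Type*} [RCLike 𝕜]

theorem ruelle_integrand_continuous (f : HolderSpace M γ ℝ) (φ : HolderSpace M γ 𝕜) :
    Continuous fun p : (ℕ → M) × M =>
      ((Real.exp (f (consSeq p.2 p.1)) : ℝ) : 𝕜) * φ (consSeq p.2 p.1) := by
  have hc : Continuous fun p : (ℕ → M) × M => consSeq p.2 p.1 :=
    continuous_consSeq.comp (continuous_snd.prodMk continuous_fst)
  exact (RCLike.continuous_ofReal.comp (Real.continuous_exp.comp (f.continuous.comp hc))).mul
    (φ.continuous.comp hc)

theorem ruelle_integrand_norm_le (f : HolderSpace M γ ℝ) (φ : HolderSpace M γ 𝕜) (z : ℕ → M) :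
    ‖((Real.exp (f z) : ℝ) : 𝕜) * φ z‖ ≤ Real.exp ‖f.toCont‖ * ‖φ.toCont‖ := by
  rw [norm_mul, RCLike.norm_ofReal, abs_of_pos (Real.exp_pos _)]
  gcongr
  · exact (le_abs_self _).trans (f.norm_apply_le z)
  · exact φ.norm_apply_le z

theorem exp_sub_exp_abs_le {s t R : ℝ} (hs : |s| ≤ R) (ht : |t| ≤ R) :
    |Real.exp s - Real.exp t| ≤ Real.exp R * |s - t| := by
  wlog h : t ≤ s generalizing s t
  · rw [abs_sub_comm, abs_sub_comm s t]
    exact this ht hs (le_of_not_ge h)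
  rw [abs_of_nonneg (sub_nonneg.2 (Real.exp_le_exp.2 h)), abs_of_nonneg (sub_nonneg.2 h)]
  have h1 : Real.exp t = Real.exp s * Real.exp (t - s) := by rw [← Real.exp_add]; ring_nf
  have h2 := Real.add_one_le_exp (t - s)
  have h3 : Real.exp s ≤ Real.exp R := Real.exp_le_exp.2 ((le_abs_self s).trans hs)
  have h4 : Real.exp s * (s - t) ≤ Real.exp R * (s - t) :=
    mul_le_mul_of_nonneg_right h3 (sub_nonneg.2 h)
  nlinarith [Real.exp_pos s]

theorem ruelle_integrand_sub_le (f : HolderSpace M γ ℝ) (φ : HolderSpace M γ 𝕜) (z w : ℕ → M) :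
    ‖((Real.exp (f z) : ℝ) : 𝕜) * φ z - ((Real.exp (f w) : ℝ) : 𝕜) * φ w‖
      ≤ Real.exp ‖f.toCont‖ * (1 + nnHolderNorm γ f) * ‖φ‖ * dist z w ^ (γ : ℝ) := by
  have e : ((Real.exp (f z) : ℝ) : 𝕜) * φ z - ((Real.exp (f w) : ℝ) : 𝕜) * φ w
      = ((Real.exp (f z) : ℝ) : 𝕜) * (φ z - φ w)
        + ((Real.exp (f z) - Real.exp (f w) : ℝ) : 𝕜) * φ w := by
    push_cast
    ring
  have hz : |f z| ≤ ‖f.toCont‖ := f.norm_apply_le z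
  have hw : |f w| ≤ ‖f.toCont‖ := f.norm_apply_le w
  have hd : 0 ≤ dist z w ^ (γ : ℝ) := by positivity
  have h1 : ‖((Real.exp (f z) : ℝ) : 𝕜) * (φ z - φ w)‖
      ≤ Real.exp ‖f.toCont‖ * (nnHolderNorm γ φ * dist z w ^ (γ : ℝ)) := by
    rw [norm_mul, RCLike.norm_ofReal, abs_of_pos (Real.exp_pos _)]
    gcongr
    · exact (le_abs_self _).trans hz
    · exact φ.norm_sub_le z w
  have h2 : ‖((Real.exp (f z) - Real.exp (f w) : ℝ) : 𝕜) * φ w‖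
      ≤ (Real.exp ‖f.toCont‖ * (nnHolderNorm γ f * dist z w ^ (γ : ℝ))) * ‖φ.toCont‖ := by
    rw [norm_mul, RCLike.norm_ofReal]
    gcongr
    · refine (exp_sub_exp_abs_le hz hw).trans ?_
      gcongr
      exact f.norm_sub_le z w
    · exact φ.norm_apply_le w
  rw [e]
  refine (norm_add_le _ _).trans ((add_le_add h1 h2).trans ?_)
  rw [HolderSpace.norm_def φ]
  have hE := (Real.exp_pos ‖f.toCont‖).le
  have hA : 0 ≤ ‖φ.toCont‖ := norm_nonneg _
  have hB : (0 : ℝ) ≤ nnHolderNorm γ φ := NNReal.coe_nonneg _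
  have hC : (0 : ℝ) ≤ nnHolderNorm γ f := NNReal.coe_nonneg _
  have hP : 0 ≤ Real.exp ‖f.toCont‖ * dist z w ^ (γ : ℝ)
      * (‖φ.toCont‖ + nnHolderNorm γ f * nnHolderNorm γ φ) := by positivity
  nlinarith [hP]

variable [MeasurableSpace M] [BorelSpace M]

theorem ruelle_integrand_integrable (μ : Measure M) [IsProbabilityMeasure μ]
    (f : HolderSpace M γ ℝ) (φ : HolderSpace M γ 𝕜) (x : ℕ → M) :
    Integrable (fun a => ((Real.exp (f (consSeq a x)) : ℝ) : 𝕜) * φ (consSeq a x)) μ := by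
  have hc : Continuous fun a : M =>
      ((Real.exp (f (consSeq a x)) : ℝ) : 𝕜) * φ (consSeq a x) :=
    (ruelle_integrand_continuous f φ).comp (continuous_const.prodMk continuous_id)
  exact Integrable.of_bound hc.aestronglyMeasurable _
    (ae_of_all _ fun a => ruelle_integrand_norm_le f φ (consSeq a x))

theorem ruelleFun_sub_le (μ : Measure M) [IsProbabilityMeasure μ]
    (f : HolderSpace M γ ℝ) (φ : HolderSpace M γ 𝕜) (x y : ℕ → M) :
    ‖ruelleFun 𝕜 μ f φ x - ruelleFun 𝕜 μ f φ y‖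
      ≤ Real.exp ‖f.toCont‖ * (1 + nnHolderNorm γ f) * ‖φ‖ * dist x y ^ (γ : ℝ) := by
  unfold ruelleFun
  rw [← integral_sub (ruelle_integrand_integrable μ f φ x) (ruelle_integrand_integrable μ f φ y)]
  have hb := norm_integral_le_of_norm_le_const (μ := μ)
    (C := Real.exp ‖f.toCont‖ * (1 + nnHolderNorm γ f) * ‖φ‖ * dist x y ^ (γ : ℝ))
    (ae_of_all μ fun a => (ruelle_integrand_sub_le f φ (consSeq a x) (consSeq a y)).trans (by
      gcongr
      rw [dist_consSeq]
      linarith [dist_nonneg (x := x) (y := y)]))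
  simpa using hb

theorem ruelleFun_norm_le (μ : Measure M) [IsProbabilityMeasure μ]
    (f : HolderSpace M γ ℝ) (φ : HolderSpace M γ 𝕜) (x : ℕ → M) :
    ‖ruelleFun 𝕜 μ f φ x‖ ≤ Real.exp ‖f.toCont‖ * ‖φ.toCont‖ := by
  have hb := norm_integral_le_of_norm_le_const (μ := μ)
    (ae_of_all μ fun a => ruelle_integrand_norm_le f φ (consSeq a x))
  simpa [ruelleFun] using hb

theorem ruelleFun_continuous (μ : Measure M) [IsProbabilityMeasure μ]
    (f : HolderSpace M γ ℝ) (φ : HolderSpace M γ 𝕜) : Continuous (ruelleFun 𝕜 μ f φ) := by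
  refine continuous_of_dominated
    (bound := fun _ => Real.exp ‖f.toCont‖ * ‖φ.toCont‖)
    (fun x => (ruelle_integrand_integrable μ f φ x).aestronglyMeasurable)
    (fun x => ae_of_all _ fun a => ruelle_integrand_norm_le f φ (consSeq a x))
    (integrable_const _)
    (ae_of_all _ fun a =>
      (ruelle_integrand_continuous f φ).comp (continuous_id.prodMk continuous_const))

theorem ruelleFun_holderWith (μ : Measure M) [IsProbabilityMeasure μ]
    (f : HolderSpace M γ ℝ) (φ : HolderSpace M γ 𝕜) :
    HolderWith (Real.exp ‖f.toCont‖ * (1 + nnHolderNorm γ f) * ‖φ‖).toNNReal γ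
      (ruelleFun 𝕜 μ f φ) := by
  refine HolderSpace.holderWith_of_norm_sub_le fun x y => ?_
  rw [Real.coe_toNNReal _ (by positivity)]
  exact ruelleFun_sub_le μ f φ x y

/-- The Ruelle operator `𝓛_f : C^γ(Ω) → C^γ(Ω)` as a bounded linear operator. -/
def ruelleOperator (𝕜 : Type*) [RCLike 𝕜] (μ : Measure M) [IsProbabilityMeasure μ]
    (f : HolderSpace M γ ℝ) : HolderSpace M γ 𝕜 →L[𝕜] HolderSpace M γ 𝕜 :=
  LinearMap.mkContinuous
    { toFun := fun φ =>
        (⟨⟨ruelleFun 𝕜 μ f φ, ruelleFun_continuous μ f φ⟩,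
          (ruelleFun_holderWith μ f φ).memHolder⟩ : ↥(holderSubmodule M γ 𝕜))
      map_add' := fun φ ψ => by
        refine DFunLike.ext (F := HolderSpace M γ 𝕜) _ _ fun x => ?_
        change ruelleFun 𝕜 μ f (φ + ψ) x = ruelleFun 𝕜 μ f φ x + ruelleFun 𝕜 μ f ψ x
        unfold ruelleFun
        rw [← integral_add (ruelle_integrand_integrable μ f φ x)
          (ruelle_integrand_integrable μ f ψ x)]
        exact integral_congr_ae (ae_of_all _ fun a => by simp [mul_add])
      map_smul' := fun c φ => by
        refine DFunLike.ext (F := HolderSpace M γ 𝕜) _ _ fun x => ?_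
        change ruelleFun 𝕜 μ f (c • ⇑φ) x = c * ruelleFun 𝕜 μ f φ x
        unfold ruelleFun
        rw [← integral_const_mul]
        exact integral_congr_ae (ae_of_all _ fun a => by
          simp only [Pi.smul_apply, smul_eq_mul]
          ring) }
    (Real.exp ‖f.toCont‖ + Real.exp ‖f.toCont‖ * (1 + nnHolderNorm γ f)) fun φ => by
      have h1 : ‖(⟨ruelleFun 𝕜 μ f φ, ruelleFun_continuous μ f φ⟩ : C(ℕ → M, 𝕜))‖
          ≤ Real.exp ‖f.toCont‖ * ‖φ.toCont‖ :=
        (ContinuousMap.norm_le _ (by positivity)).2 (ruelleFun_norm_le μ f φ)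
      have h2 : (nnHolderNorm γ (ruelleFun 𝕜 μ f φ) : ℝ)
          ≤ Real.exp ‖f.toCont‖ * (1 + nnHolderNorm γ f) * ‖φ‖ := by
        have h := NNReal.coe_le_coe.2 (ruelleFun_holderWith μ f φ).nnholderNorm_le
        rwa [Real.coe_toNNReal _ (by positivity)] at h
      have h3 : ‖φ.toCont‖ ≤ ‖φ‖ := by
        rw [HolderSpace.norm_def]
        exact le_add_of_nonneg_right (NNReal.coe_nonneg _)
      have h4 : Real.exp ‖f.toCont‖ * ‖φ.toCont‖ ≤ Real.exp ‖f.toCont‖ * ‖φ‖ := by gcongr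
      change ‖(⟨ruelleFun 𝕜 μ f φ, ruelleFun_continuous μ f φ⟩ : C(ℕ → M, 𝕜))‖
          + (nnHolderNorm γ (ruelleFun 𝕜 μ f φ) : ℝ) ≤ _
      rw [add_mul]
      exact add_le_add (h1.trans h4) h2

theorem ruelleOperator_apply (μ : Measure M) [IsProbabilityMeasure μ]
    (f : HolderSpace M γ ℝ) (φ : HolderSpace M γ 𝕜) (x : ℕ → M) :
    ruelleOperator 𝕜 μ f φ x
      = ∫ a, ((Real.exp (f (consSeq a x)) : ℝ) : 𝕜) * φ (consSeq a x) ∂μ := rfl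

end RuelleOperator

noncomputable section LeadingEigenvalue

/-! ## The main eigenvalue `λ_f`, entropy and pressure -/

/-- The spectral projector `(2πi)⁻¹ ∮_{|z - c| = R} (z - T)⁻¹ dz`. -/
def spectralProjector {X : Type*} [NormedAddCommGroup X] [NormedSpace ℂ X]
    (T : X →L[ℂ] X) (c : ℂ) (R : ℝ) : X →L[ℂ] X :=
  (2 * Real.pi * Complex.I : ℂ)⁻¹ • circleIntegral (fun z => resolvent T z) c R

/-- `c` is an isolated simple eigenvalue of `T`: an eigenvalue isolated in the spectrum whose
spectral projector has one-dimensional image. -/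
def IsSimpleIsolatedEigenvalue {X : Type*} [NormedAddCommGroup X] [NormedSpace ℂ X]
    (T : X →L[ℂ] X) (c : ℂ) : Prop :=
  (∃ v : X, v ≠ 0 ∧ T v = c • v) ∧
    ∃ R : ℝ, 0 < R ∧ Metric.closedBall c R ∩ spectrum ℂ T = {c} ∧
      Module.finrank ℂ (spectralProjector T c R).range = 1

/-- `t` is a simple positive eigenvalue of maximal modulus of `T`, the remainder of the spectrum
being contained in a disc of radius strictly smaller than `t`. -/
def IsMainEigenvalue {X : Type*} [NormedAddCommGroup X] [NormedSpace ℂ X]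
    (T : X →L[ℂ] X) (t : ℝ) : Prop :=
  0 < t ∧ IsSimpleIsolatedEigenvalue T (t : ℂ) ∧
    ∃ r : ℝ, r < t ∧ ∀ z ∈ spectrum ℂ T, z ≠ (t : ℂ) → ‖z‖ ≤ r

theorem IsMainEigenvalue.unique {X : Type*} [NormedAddCommGroup X] [NormedSpace ℂ X]
    {T : X →L[ℂ] X} {s t : ℝ} (hs : IsMainEigenvalue T s) (ht : IsMainEigenvalue T t) :
    s = t := by
  have key : ∀ {s t : ℝ}, IsMainEigenvalue T s → IsMainEigenvalue T t → s ≠ t → s < t := by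
    rintro s t ⟨hs0, ⟨-, R, -, hR, -⟩, -⟩ ⟨-, -, r, hr, h⟩ hne
    have hmem : (s : ℂ) ∈ spectrum ℂ T := by
      have : (s : ℂ) ∈ Metric.closedBall (s : ℂ) R ∩ spectrum ℂ T := by rw [hR]; rfl
      exact this.2
    have h1 := h _ hmem (fun h => hne (Complex.ofReal_injective h))
    rw [Complex.norm_real, Real.norm_of_nonneg hs0.le] at h1
    exact h1.trans_lt hr
  by_contra hne
  exact lt_asymm (key hs ht hne) (key ht hs (Ne.symm hne))

variable {M : Type*} [MetricSpace M] [CompactSpace M] [MeasurableSpace M] [BorelSpace M]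
variable {γ : ℝ≥0}

open Classical in
/-- `λ_f`: the main eigenvalue of the Ruelle operator `𝓛_f` on (the complexification of)
`C^γ(Ω)`; it is unique by `IsMainEigenvalue.unique`. -/
def mainEigenvalue (μ : Measure M) [IsProbabilityMeasure μ] (f : HolderSpace M γ ℝ) : ℝ :=
  if h : ∃ t : ℝ, IsMainEigenvalue (ruelleOperator ℂ μ f) t then h.choose else 0

/-- The entropy `h(ν) = inf_{g ∈ C^γ(Ω)} (- ∫ g dν + log λ_g)`, possibly `-∞`. -/
def entropyOf (γ : ℝ≥0) (μ : Measure M) [IsProbabilityMeasure μ] (ν : Measure (ℕ → M)) : EReal :=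
  ⨅ g : HolderSpace M γ ℝ, ((-(∫ x, g x ∂ν) + Real.log (mainEigenvalue μ g) : ℝ) : EReal)

/-- The pressure `P(f) = sup_ν (h(ν) + ∫ f dν)`, over the shift-invariant Borel probability
measures `ν` on `Ω`. -/
def pressure (μ : Measure M) [IsProbabilityMeasure μ] (f : HolderSpace M γ ℝ) : EReal :=
  ⨆ (ν : Measure (ℕ → M)) (_ : IsProbabilityMeasure ν)
    (_ : MeasurePreserving (shiftSeq : (ℕ → M) → (ℕ → M)) ν ν),
    (entropyOf γ μ ν + ((∫ x, f x ∂ν : ℝ) : EReal))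

end LeadingEigenvalue

/-! ### Spectral consequences of exponential convergence to a rank-one operator. -/

section SpectralGap

/-! Eigenvalue. The functions with `K`-Hölder logarithm form a cone. Since `ax` and `ay` are half as
far apart as `x` and `y`, for a suitable `K` the real Ruelle operator maps this cone into the one
with constant `K - 1` (`exists_coneContraction`). This strict inclusion squeezes `𝓛_f ^ n φ` between
multiples of `𝓛_f ^ n 1` whose coefficients approach each other geometrically. It yields `λ_f > 0`,
an eigenfunction `e^k`, a positive eigenfunctional `ℓ`, and exponential convergence to the rank-one
part (`ConeContraction.exists_hasSpectralGap`). After complexification, that convergence determines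
the resolvent well enough to read off the spectrum and the projector
(`HasSpectralGap.isMainEigenvalue`).

Variational principle. The functional `φ ↦ ℓ (e^k φ)` is integration against a shift-invariant
probability measure `ν_f`. Changing `g - f` by a coboundary and using convexity of `exp` gives `log
λ_g ≥ log λ_f + ∫ (g - f) dν_f` for all `g` (`HasSpectralGap.log_add_functional_le`). Hence `h(ν_f)
≥ log λ_f - ∫ f dν_f`, which is the lower bound for the pressure; the upper bound is the choice `g =
f` in the infimum defining the entropy.

Analyticity. `𝓛_f` is `𝓛_0` after multiplication by `e^f`, hence analytic in `f`. The implicit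
function theorem continues the eigenvector analytically. For `g` near `f` it stays positive, so
pairing it with the positive eigenfunctional of `𝓛_g` shows that its eigenvalue is `λ_g`. -/

theorem isUnit_one_sub_of_norm_pow_lt_one {A : Type*} [NormedRing A] [CompleteSpace A] {a : A}
    {n : ℕ} (h : ‖a ^ n‖ < 1) : IsUnit (1 - a) := by
  have h1 : IsUnit (1 - a ^ n) := isUnit_one_sub_of_norm_lt_one h
  rw [← mul_neg_geom_sum a n] at h1
  refine ((Commute.isUnit_mul_iff ?_).1 h1).1
  exact Commute.sub_left (Commute.one_left _)
    (Commute.sum_right _ _ _ fun i _ => Commute.pow_right (Commute.refl a) i)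

variable {𝕜 : Type*} [RCLike 𝕜] {E : Type*} [NormedAddCommGroup E] [NormedSpace 𝕜 E]

/-- `lam` is a positive eigenvalue of `T` with eigenvector `h` and eigenfunctional `ℓ`, and the
powers of `T` approach those of its rank one part `φ ↦ lam * ℓ φ • h` exponentially fast relative
to `lam ^ n`. -/
structure HasSpectralGap (T : E →L[𝕜] E) (lam : ℝ) (ℓ : E →L[𝕜] 𝕜) (h : E) : Prop where
  pos : 0 < lam
  map_eigenvector : T h = (lam : 𝕜) • h
  map_functional : ∀ φ, ℓ (T φ) = lam * ℓ φ
  normalized : ℓ h = 1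
  decay : ∃ C ρ : ℝ, 0 ≤ C ∧ 0 ≤ ρ ∧ ρ < 1 ∧
    ∀ n φ, ‖(T ^ n) φ - ((lam : 𝕜) ^ n * ℓ φ) • h‖ ≤ C * (ρ * lam) ^ n * ‖φ‖

namespace HasSpectralGap

variable {T : E →L[𝕜] E} {lam : ℝ} {ℓ : E →L[𝕜] 𝕜} {h : E}

theorem functional_pow (H : HasSpectralGap T lam ℓ h) (n : ℕ) (φ : E) :
    ℓ ((T ^ n) φ) = (lam : 𝕜) ^ n * ℓ φ := by
  induction n with
  | zero => simp
  | succ n ih =>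
    rw [pow_succ', mul_apply_eq_comp, H.map_functional, ih]
    ring

/-- As `h` and `ℓ` are eigenvectors of `T` and of its transpose for the same eigenvalue, the cross
terms cancel. The exponent starts at one because the zeroth power on the left is the identity,
without the rank-one correction. -/
theorem remainder_pow (H : HasSpectralGap T lam ℓ h) (n : ℕ) (φ : E) :
    ((T - (lam : 𝕜) • ℓ.smulRight h) ^ (n + 1)) φ
      = (T ^ (n + 1)) φ - ((lam : 𝕜) ^ (n + 1) * ℓ φ) • h := by
  induction n with
  | zero => simp [mul_smul]
  | succ n ih =>
    rw [pow_succ', mul_apply_eq_comp, ih]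
    simp only [sub_apply, map_sub, map_smul, smul_apply,
      ContinuousLinearMap.smulRight_apply, H.map_eigenvector, H.functional_pow, H.normalized]
    rw [pow_succ' T (n + 1), mul_apply_eq_comp]
    module

/-- By `decay`, the powers of the remainder grow at most like `(ρ * lam) ^ n`, so for `‖z‖ > ρ *
lam` some power of `z⁻¹ • N` has norm below one. -/
theorem exists_isUnit_sub_remainder [CompleteSpace E] (H : HasSpectralGap T lam ℓ h) :
    ∃ r : ℝ, 0 ≤ r ∧ r < lam ∧ ∀ z : 𝕜, r < ‖z‖ →
      IsUnit (algebraMap 𝕜 (E →L[𝕜] E) z - (T - (lam : 𝕜) • ℓ.smulRight h)) := by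
  obtain ⟨C, ρ, hC, hρ0, hρ1, hdec⟩ := H.decay
  refine ⟨ρ * lam, mul_nonneg hρ0 H.pos.le, by nlinarith [H.pos], fun z hz => ?_⟩
  have hz0' : 0 < ‖z‖ := (mul_nonneg hρ0 H.pos.le).trans_lt hz
  have hz0 : z ≠ 0 := norm_pos_iff.1 hz0'
  set N := T - (lam : 𝕜) • ℓ.smulRight h with hN
  have hnorm : ∀ n : ℕ, ‖(z⁻¹ • N) ^ (n + 1)‖ ≤ C * (ρ * lam / ‖z‖) ^ (n + 1) := by
    intro n
    refine ContinuousLinearMap.opNorm_le_bound _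
      (mul_nonneg hC (pow_nonneg (div_nonneg (mul_nonneg hρ0 H.pos.le) hz0'.le) _)) fun φ => ?_
    rw [smul_pow, smul_apply, H.remainder_pow, norm_smul, norm_pow, norm_inv,
      div_pow]
    calc (‖z‖⁻¹) ^ (n + 1) * ‖(T ^ (n + 1)) φ - ((lam : 𝕜) ^ (n + 1) * ℓ φ) • h‖
        ≤ (‖z‖⁻¹) ^ (n + 1) * (C * (ρ * lam) ^ (n + 1) * ‖φ‖) := by
          gcongr
          exact hdec _ _
      _ = _ := by
          rw [inv_pow]
          field_simp
  have hlim : Tendsto (fun n : ℕ => C * (ρ * lam / ‖z‖) ^ (n + 1)) atTop (𝓝 (C * 0)) := by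
    refine Tendsto.const_mul _ ((tendsto_add_atTop_iff_nat 1).2
      (tendsto_pow_atTop_nhds_zero_of_lt_one (div_nonneg (mul_nonneg hρ0 H.pos.le) hz0'.le) ?_))
    rwa [div_lt_one hz0']
  rw [mul_zero] at hlim
  obtain ⟨n, hn⟩ := (hlim.eventually_lt_const one_pos).exists
  have h1 : IsUnit (1 - z⁻¹ • N) := isUnit_one_sub_of_norm_pow_lt_one ((hnorm n).trans_lt hn)
  have h2 : algebraMap 𝕜 (E →L[𝕜] E) z - N = algebraMap 𝕜 (E →L[𝕜] E) z * (1 - z⁻¹ • N) := by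
    rw [mul_sub, mul_one, Algebra.algebraMap_eq_smul_one, smul_mul_smul_comm, one_mul,
      mul_inv_cancel₀ hz0, one_smul]
  rw [h2]
  exact ((isUnit_iff_ne_zero.2 hz0).map (algebraMap 𝕜 (E →L[𝕜] E))).mul h1

theorem ne_zero (H : HasSpectralGap T lam ℓ h) : h ≠ 0 := by
  rintro rfl
  have := H.normalized
  simp at this

end HasSpectralGap

/-- `N` vanishes on the image of `Q`, so there its resolvent is `z⁻¹`; adding `c • Q` only replaces
this by `(z - c)⁻¹`. -/
theorem resolvent_add_smul_idempotent {𝕜 A : Type*} [Field 𝕜] [Ring A] [Algebra 𝕜 A]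
    {N Q : A} {c z : 𝕜} (hNQ : N * Q = 0) (hQN : Q * N = 0) (hQ : Q * Q = Q) (hz : z ≠ 0)
    (hzc : z ≠ c) (hu : IsUnit (algebraMap 𝕜 A z - N)) :
    IsUnit (algebraMap 𝕜 A z - (N + c • Q)) ∧
      resolvent (N + c • Q) z = (resolvent N z - z⁻¹ • Q) + (z - c)⁻¹ • Q := by
  have hzc' : z - c ≠ 0 := sub_ne_zero.2 hzc
  set R := resolvent N z with hR
  have h1 : (algebraMap 𝕜 A z - N) * R = 1 := Ring.mul_inverse_cancel _ hu
  have h2 : R * (algebraMap 𝕜 A z - N) = 1 := Ring.inverse_mul_cancel _ hu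
  have h3 : Q * R = z⁻¹ • Q := by
    have : Q * ((algebraMap 𝕜 A z - N) * R) = z • (Q * R) := by
      rw [← mul_assoc, mul_sub, hQN, sub_zero, Algebra.algebraMap_eq_smul_one, mul_smul_comm,
        mul_one, smul_mul_assoc]
    rw [h1, mul_one] at this
    rw [this, smul_smul, inv_mul_cancel₀ hz, one_smul, ← this]
  have h4 : R * Q = z⁻¹ • Q := by
    have : (R * (algebraMap 𝕜 A z - N)) * Q = z • (R * Q) := by
      rw [mul_assoc, sub_mul, hNQ, sub_zero, Algebra.algebraMap_eq_smul_one, smul_mul_assoc,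
        one_mul, mul_smul_comm]
    rw [h2, one_mul] at this
    rw [this, smul_smul, inv_mul_cancel₀ hz, one_smul, ← this]
  have key : z⁻¹ * z = 1 := inv_mul_cancel₀ hz
  have e1 : (algebraMap 𝕜 A z - (N + c • Q)) * ((R - z⁻¹ • Q) + (z - c)⁻¹ • Q) = 1 := by
    have : algebraMap 𝕜 A z - (N + c • Q) = (algebraMap 𝕜 A z - N) - c • Q := by abel
    rw [this, sub_mul, mul_add, mul_sub, h1]
    simp only [mul_smul_comm, sub_mul, hNQ, mul_add, mul_sub, smul_mul_assoc, h3, hQ,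
      Algebra.algebraMap_eq_smul_one, one_mul]
    match_scalars <;> field_simp
    ring
  have e2 : ((R - z⁻¹ • Q) + (z - c)⁻¹ • Q) * (algebraMap 𝕜 A z - (N + c • Q)) = 1 := by
    have : algebraMap 𝕜 A z - (N + c • Q) = (algebraMap 𝕜 A z - N) - c • Q := by abel
    rw [this, mul_sub, add_mul, sub_mul, h2]
    simp only [mul_smul_comm, mul_sub, hQN, add_mul, sub_mul, smul_mul_assoc, h4, hQ,
      Algebra.algebraMap_eq_smul_one, mul_one]
    match_scalars <;> field_simp
    ring
  let u : Aˣ := ⟨_, _, e1, e2⟩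
  exact ⟨u.isUnit, Ring.inverse_unit u⟩

/-- Outside the disc of radius `r` the resolvent is a holomorphic part plus a simple pole at `lam`
with residue `Q`. By Cauchy's theorem the spectral projector is `Q`, whose image is spanned by `h`.
-/
theorem HasSpectralGap.isMainEigenvalue {E : Type*} [NormedAddCommGroup E] [NormedSpace ℂ E]
    [CompleteSpace E] {T : E →L[ℂ] E} {lam : ℝ} {ℓ : E →L[ℂ] ℂ} {h : E}
    (H : HasSpectralGap T lam ℓ h) : IsMainEigenvalue T lam := by
  obtain ⟨r, hr0, hrl, hunit⟩ := H.exists_isUnit_sub_remainder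
  set Q : E →L[ℂ] E := ℓ.smulRight h with hQdef
  set N := T - (lam : ℂ) • Q with hN
  have hTN : T = N + (lam : ℂ) • Q := by rw [hN]; abel
  have hQQ : Q * Q = Q := by
    ext φ
    simp [hQdef, H.normalized]
  have hNQ : N * Q = 0 := by
    ext φ
    simp [hN, hQdef, H.normalized, H.map_eigenvector]
  have hQN : Q * N = 0 := by
    ext φ
    simp [hN, hQdef, H.normalized, H.map_functional]
  have hspec : ∀ z : ℂ, r < ‖z‖ → z ≠ (lam : ℂ) →
      IsUnit (algebraMap ℂ (E →L[ℂ] E) z - T) ∧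
        resolvent T z = (resolvent N z - z⁻¹ • Q) + (z - lam)⁻¹ • Q := by
    intro z hz hzl
    have hz0 : z ≠ 0 := norm_pos_iff.1 (hr0.trans_lt hz)
    rw [hTN]
    exact resolvent_add_smul_idempotent hNQ hQN hQQ hz0 hzl (hunit z hz)
  have hmem : (lam : ℂ) ∈ spectrum ℂ T := by
    intro hu
    have hinj := (ContinuousLinearMap.isUnit_iff_bijective.1 hu).1
    refine H.ne_zero (hinj ?_)
    simp only [sub_apply, ContinuousLinearMap.algebraMap_apply, map_zero]
    rw [H.map_eigenvector]
    exact sub_self _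
  -- Half the gap keeps the closed disc around `lam` off the disc of radius `r`, and hence off the
  -- pole of `z⁻¹`.
  set R := (lam - r) / 2 with hRdef
  have hR : 0 < R := by rw [hRdef]; linarith
  have hball : ∀ z ∈ Metric.closedBall (lam : ℂ) R, r < ‖z‖ := by
    intro z hz
    rw [Metric.mem_closedBall, dist_eq_norm] at hz
    have h1 : ‖(lam : ℂ)‖ = lam := by
      rw [Complex.norm_real, Real.norm_of_nonneg H.pos.le]
    have h2 := norm_sub_norm_le (lam : ℂ) z
    rw [norm_sub_rev, h1] at h2
    rw [hRdef] at hz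
    linarith
  refine ⟨H.pos, ⟨⟨h, H.ne_zero, H.map_eigenvector⟩, R, hR, ?_, ?_⟩, r, hrl, ?_⟩
  · ext z
    constructor
    · rintro ⟨hz1, hz2⟩
      by_contra hne
      exact hz2 (hspec z (hball z hz1) hne).1
    · rintro rfl
      exact ⟨Metric.mem_closedBall_self hR.le, hmem⟩
  · have hproj : spectralProjector T lam R = Q := by
      have hcongr : circleIntegral (fun z => resolvent T z) lam R
          = circleIntegral (fun z => (resolvent N z - z⁻¹ • Q) + (z - lam)⁻¹ • Q) lam R := by
        refine circleIntegral.integral_congr hR.le fun z hz => ?_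
        refine (hspec z (hball z (Metric.sphere_subset_closedBall hz)) ?_).2
        rintro rfl
        simp only [Metric.mem_sphere, dist_self] at hz
        exact hR.ne hz
      have hdiff : ∀ z ∈ Metric.closedBall (lam : ℂ) R,
          DifferentiableAt ℂ (fun z => resolvent N z - z⁻¹ • Q) z := by
        intro z hz
        have hz0 : z ≠ 0 := norm_pos_iff.1 (hr0.trans_lt (hball z hz))
        have h1 : z ∈ resolventSet ℂ N := hunit z (hball z hz)
        exact (spectrum.hasDerivAt_resolvent_const_left h1).differentiableAt.sub
          ((differentiableAt_inv hz0).smul_const Q)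
      have hcont : ContinuousOn (fun z => resolvent N z - z⁻¹ • Q)
          (Metric.closedBall (lam : ℂ) R) := fun z hz =>
        (hdiff z hz).continuousAt.continuousWithinAt
      have hzero : circleIntegral (fun z => resolvent N z - z⁻¹ • Q) lam R = 0 :=
        Complex.circleIntegral_eq_zero_of_differentiable_on_off_countable hR.le
          countable_empty hcont fun z hz => hdiff z (Metric.ball_subset_closedBall hz.1)
      have hcont2 : ContinuousOn (fun z : ℂ => (z - lam)⁻¹ • Q) (Metric.sphere (lam : ℂ) R) := by
        refine ContinuousOn.smul (ContinuousOn.inv₀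
          (continuousOn_id.sub continuousOn_const) fun z hz => ?_)
          continuousOn_const
        change z - (lam : ℂ) ≠ 0
        rw [sub_ne_zero]
        rintro rfl
        simp only [Metric.mem_sphere, dist_self] at hz
        exact hR.ne hz
      rw [spectralProjector, hcongr, circleIntegral.integral_add
        ((hcont.mono Metric.sphere_subset_closedBall).circleIntegrable hR.le)
        (hcont2.circleIntegrable hR.le), hzero, zero_add, circleIntegral.integral_smul_const,
        circleIntegral.integral_sub_center_inv _ hR.ne', smul_smul, inv_mul_cancel₀, one_smul]
      exact Complex.two_pi_I_ne_zero
    rw [hproj]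
    have hrange : Q.range = Submodule.span ℂ {h} := by
      ext v
      rw [Submodule.mem_span_singleton]
      constructor
      · rintro ⟨φ, rfl⟩
        exact ⟨ℓ φ, rfl⟩
      · rintro ⟨c, rfl⟩
        exact ⟨c • h, by simp [hQdef, H.normalized]⟩
    rw [hrange]
    exact finrank_span_singleton H.ne_zero
  · intro z hz hne
    by_contra! hlt
    exact hz (hspec z hlt hne).1

end SpectralGap

/-! ### Cone contraction implies a spectral gap. -/

section ConeContraction

/-- A self-improving cone condition: `T` maps the cone `P` into a smaller cone `P'`, from whose
elements one may subtract a definite fraction of any other element of `P'` (compared through the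
functional `e`) without leaving `P`. -/
structure ConeContraction {E : Type*} [NormedAddCommGroup E] [NormedSpace ℝ E] (T : E →L[ℝ] E)
    (e : E →L[ℝ] ℝ) (one : E) (P P' : E → Prop) (C D δ : ℝ) : Prop where
  C_pos : 0 < C
  D_nonneg : 0 ≤ D
  δ_pos : 0 < δ
  δ_lt_one : δ < 1
  one_mem : P' one
  orbit_pos : ∀ n, 0 < e ((T ^ n) one)
  map_mem : ∀ φ, P φ → P' (T φ)
  sub_mem : ∀ φ χ, P' φ → P' χ → 0 < e χ → P (φ - (δ * (e φ / e χ)) • χ)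
  mono : ∀ φ, P' φ → P φ
  norm_le : ∀ φ, P φ → ‖φ‖ ≤ C * e φ
  add_mem : ∀ φ, P (φ + (D * ‖φ‖) • one)
  smul_mem : ∀ (c : ℝ) φ, 0 ≤ c → P φ → P (c • φ)
  closed : IsClosed {φ | P φ}

namespace ConeContraction

variable {E : Type*} [NormedAddCommGroup E] [NormedSpace ℝ E] {T : E →L[ℝ] E}
  {e : E →L[ℝ] ℝ} {one : E} {P P' : E → Prop} {C D δ : ℝ}

theorem eval_nonneg (H : ConeContraction T e one P P' C D δ) {φ : E} (h : P φ) : 0 ≤ e φ :=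
  nonneg_of_mul_nonneg_right ((norm_nonneg _).trans (H.norm_le φ h)) H.C_pos

theorem orbit_mem (H : ConeContraction T e one P P' C D δ) (n : ℕ) {φ : E} (h : P' φ) :
    P' ((T ^ n) φ) := by
  induction n with
  | zero => simpa using h
  | succ n ih =>
    rw [pow_succ', mul_apply_eq_comp]
    exact H.map_mem _ (H.mono _ ih)

theorem orbit_mem' (H : ConeContraction T e one P P' C D δ) (n : ℕ) {φ : E} (h : P φ) :
    P ((T ^ n) φ) := by
  induction n with
  | zero => simpa using h
  | succ n ih =>
    rw [pow_succ', mul_apply_eq_comp]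
    exact H.mono _ (H.map_mem _ ih)

/-- In the order defined by `P`, the iterate lies between `a` and `b` times that of `one`. After one
more application of `T`, `sub_mem` moves each endpoint by the fraction `δ` of its distance to the
current ratio of `e`-values, so the length shrinks by exactly `1 - δ`. -/
theorem exists_sandwich (H : ConeContraction T e one P P' C D δ) (φ : E) (n : ℕ) :
    ∃ a b : ℝ, P ((T ^ n) φ - a • (T ^ n) one) ∧ P (b • (T ^ n) one - (T ^ n) φ) ∧
      b - a = 2 * D * ‖φ‖ * (1 - δ) ^ n := by
  induction n with
  | zero =>
    refine ⟨-(D * ‖φ‖), D * ‖φ‖, ?_, ?_, by ring⟩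
    · simpa using H.add_mem φ
    · have := H.add_mem (-φ)
      rw [norm_neg] at this
      simpa [sub_eq_add_neg, add_comm] using this
  | succ n ih =>
    obtain ⟨a, b, ha, hb, hab⟩ := ih
    have hc := H.orbit_pos (n + 1)
    have hχ := H.orbit_mem (n + 1) H.one_mem
    set χ := (T ^ (n + 1)) one with hχdef
    set ψ := (T ^ (n + 1)) φ with hψdef
    have eχ : T ((T ^ n) one) = χ := by rw [hχdef, pow_succ', mul_apply_eq_comp]
    have eψ : T ((T ^ n) φ) = ψ := by rw [hψdef, pow_succ', mul_apply_eq_comp]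
    have ha' : P' (ψ - a • χ) := by
      have := H.map_mem _ ha
      rwa [map_sub, map_smul, eχ, eψ] at this
    have hb' : P' (b • χ - ψ) := by
      have := H.map_mem _ hb
      rwa [map_sub, map_smul, eχ, eψ] at this
    have ha2 := H.sub_mem _ _ ha' hχ hc
    have hb2 := H.sub_mem _ _ hb' hχ hc
    have e1 : e (ψ - a • χ) / e χ = e ψ / e χ - a := by
      rw [map_sub, map_smul, smul_eq_mul]
      field_simp
    have e2 : e (b • χ - ψ) / e χ = b - e ψ / e χ := by
      rw [map_sub, map_smul, smul_eq_mul]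
      field_simp
    rw [e1] at ha2
    rw [e2] at hb2
    refine ⟨a + δ * (e ψ / e χ - a), b - δ * (b - e ψ / e χ), ?_, ?_, ?_⟩
    · convert ha2 using 1
      module
    · convert hb2 using 1
      module
    · rw [pow_succ, ← mul_assoc, ← hab]
      ring

/-- The ratios `e (T ^ n φ) / e (T ^ n one)`, whose limit is the eigenfunctional, at times `n` and
`n + 1` lie in an interval of geometrically small length. -/
theorem exists_sandwich_ratio (H : ConeContraction T e one P P' C D δ) (φ : E) (n : ℕ) :
    ∃ a b : ℝ, P ((T ^ n) φ - a • (T ^ n) one) ∧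
      b - a = 2 * D * ‖φ‖ * (1 - δ) ^ n ∧
      a ≤ e ((T ^ n) φ) / e ((T ^ n) one) ∧ e ((T ^ n) φ) / e ((T ^ n) one) ≤ b ∧
      a ≤ e ((T ^ (n + 1)) φ) / e ((T ^ (n + 1)) one) ∧
      e ((T ^ (n + 1)) φ) / e ((T ^ (n + 1)) one) ≤ b := by
  obtain ⟨a, b, ha, hb, hab⟩ := H.exists_sandwich φ n
  have ha' := H.orbit_mem' 1 ha
  have hb' := H.orbit_mem' 1 hb
  rw [pow_one, map_sub, map_smul, ← mul_apply_eq_comp, ← mul_apply_eq_comp,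
    ← pow_succ'] at ha' hb'
  have h1 := H.eval_nonneg ha
  have h2 := H.eval_nonneg hb
  have h3 := H.eval_nonneg ha'
  have h4 := H.eval_nonneg hb'
  rw [map_sub, map_smul, smul_eq_mul] at h1 h2 h3 h4
  refine ⟨a, b, ha, hab, ?_, ?_, ?_, ?_⟩
  · rw [le_div_iff₀ (H.orbit_pos n)]; linarith
  · rw [div_le_iff₀ (H.orbit_pos n)]; linarith
  · rw [le_div_iff₀ (H.orbit_pos (n + 1))]; linarith
  · rw [div_le_iff₀ (H.orbit_pos (n + 1))]; linarith

theorem dist_ratio_le (H : ConeContraction T e one P P' C D δ) (φ : E) (n : ℕ) :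
    dist (e ((T ^ n) φ) / e ((T ^ n) one)) (e ((T ^ (n + 1)) φ) / e ((T ^ (n + 1)) one))
      ≤ 2 * D * ‖φ‖ * (1 - δ) ^ n := by
  obtain ⟨a, b, -, hab, h1, h2, h3, h4⟩ := H.exists_sandwich_ratio φ n
  rw [Real.dist_eq, ← hab, abs_le]
  constructor <;> linarith

/-- Consecutive ratios share a sandwich interval, so they form a Cauchy sequence; each ratio is
linear in `φ`, hence so is the limit. The norm bound is the ratio at time zero plus the sum of the
geometric series. -/
theorem exists_functional (H : ConeContraction T e one P P' C D δ) :
    ∃ ℓ : E →L[ℝ] ℝ,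
      ∀ φ, Tendsto (fun n => e ((T ^ n) φ) / e ((T ^ n) one)) atTop (𝓝 (ℓ φ)) := by
  have hδ : 1 - δ < 1 := by linarith [H.δ_pos]
  have hex : ∀ φ, ∃ l, Tendsto (fun n => e ((T ^ n) φ) / e ((T ^ n) one)) atTop (𝓝 l) :=
    fun φ => cauchySeq_tendsto_of_complete
      (cauchySeq_of_le_geometric (1 - δ) (2 * D * ‖φ‖) hδ (H.dist_ratio_le φ))
  choose L hL using hex
  have hlin : ∀ (c : ℝ) φ, L (c • φ) = c • L φ := fun c φ => by
    refine tendsto_nhds_unique (hL (c • φ)) (((hL φ).const_mul c).congr fun n => ?_)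
    rw [map_smul, map_smul, smul_eq_mul, mul_div_assoc]
  have hadd : ∀ φ ψ, L (φ + ψ) = L φ + L ψ := fun φ ψ => by
    refine tendsto_nhds_unique (hL (φ + ψ)) (((hL φ).add (hL ψ)).congr fun n => ?_)
    rw [map_add, map_add, add_div]
  refine ⟨LinearMap.mkContinuous ⟨⟨L, hadd⟩, hlin⟩ (‖e‖ / e one + 2 * D / δ) fun φ => ?_, hL⟩
  have h1 := dist_le_of_le_geometric_of_tendsto (1 - δ) (2 * D * ‖φ‖) hδ (H.dist_ratio_le φ)
    (hL φ) 0
  simp only [pow_zero, mul_one, sub_sub_cancel] at h1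
  change dist (e φ / e one) (L φ) ≤ _ at h1
  have h0 : 0 < e one := by simpa using H.orbit_pos 0
  have h2 : |e φ / e one| ≤ ‖e‖ / e one * ‖φ‖ := by
    rw [abs_div, abs_of_pos h0, div_mul_eq_mul_div]
    gcongr
    exact e.le_opNorm φ
  rw [dist_comm, Real.dist_eq] at h1
  have h3 := abs_sub_abs_le_abs_sub (L φ) (e φ / e one)
  change |L φ| ≤ _
  calc |L φ| ≤ ‖e‖ / e one * ‖φ‖ + 2 * D * ‖φ‖ / δ := by linarith
    _ = _ := by ring

/-- On `P` the norm is controlled by `e`, which handles the difference with the lower endpoint `a`;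
and `a` is close to `ℓ φ` because both are close to the ratio at time `n`. -/
theorem norm_sub_functional_smul_le (H : ConeContraction T e one P P' C D δ) {ℓ : E →L[ℝ] ℝ}
    (hℓ : ∀ φ, Tendsto (fun n => e ((T ^ n) φ) / e ((T ^ n) one)) atTop (𝓝 (ℓ φ)))
    (φ : E) (n : ℕ) :
    ‖(T ^ n) φ - ℓ φ • (T ^ n) one‖
      ≤ C * (4 * D + 2 * D / δ) * (1 - δ) ^ n * ‖φ‖ * e ((T ^ n) one) := by
  have hδ : 1 - δ < 1 := by linarith [H.δ_pos]
  have h1 := dist_le_of_le_geometric_of_tendsto (1 - δ) (2 * D * ‖φ‖) hδ (H.dist_ratio_le φ)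
    (hℓ φ) n
  rw [sub_sub_cancel, Real.dist_eq] at h1
  obtain ⟨a, b, ha, hab, hr1, hr2, -, -⟩ := H.exists_sandwich_ratio φ n
  have hc := H.orbit_pos n
  set χ := (T ^ n) one with hχ
  set r := e ((T ^ n) φ) / e χ with hr
  have hχn : ‖χ‖ ≤ C * e χ := H.norm_le _ (H.mono _ (H.orbit_mem n H.one_mem))
  have h2 : ‖(T ^ n) φ - a • χ‖ ≤ C * ((r - a) * e χ) := by
    refine (H.norm_le _ ha).trans_eq ?_
    rw [map_sub, map_smul, smul_eq_mul, sub_mul, hr, div_mul_cancel₀ _ hc.ne']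
  have h3 : |a - ℓ φ| ≤ (b - a) + 2 * D * ‖φ‖ * (1 - δ) ^ n / δ := by
    have := abs_sub_le a r (ℓ φ)
    have h4 : |a - r| ≤ b - a := by rw [abs_le]; constructor <;> linarith
    linarith
  have h5 : (T ^ n) φ - ℓ φ • χ = ((T ^ n) φ - a • χ) + (a - ℓ φ) • χ := by module
  rw [h5]
  calc ‖((T ^ n) φ - a • χ) + (a - ℓ φ) • χ‖
      ≤ C * ((r - a) * e χ) + |a - ℓ φ| * ‖χ‖ := by
        refine (norm_add_le _ _).trans (add_le_add h2 ?_)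
        rw [norm_smul, Real.norm_eq_abs]
    _ ≤ C * ((b - a) * e χ)
        + ((b - a) + 2 * D * ‖φ‖ * (1 - δ) ^ n / δ) * (C * e χ) := by
        have := H.C_pos
        gcongr
        exact (abs_nonneg _).trans h3
    _ = _ := by
        rw [hab]
        ring

theorem exists_hasSpectralGap [CompleteSpace E] (H : ConeContraction T e one P P' C D δ) :
    ∃ (lam : ℝ) (ℓ : E →L[ℝ] ℝ) (h : E), HasSpectralGap T lam ℓ h ∧ P h ∧
      ∀ φ, Tendsto (fun n => e ((T ^ n) φ) / e ((T ^ n) one)) atTop (𝓝 (ℓ φ)) := by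
  obtain ⟨ℓ, hℓ⟩ := H.exists_functional
  have hδ1 : 1 - δ < 1 := by linarith [H.δ_pos]
  have hδ0 : 0 ≤ 1 - δ := by linarith [H.δ_lt_one]
  have hδp := H.δ_pos
  have hCp := H.C_pos
  have hDp := H.D_nonneg
  have hc0 : 0 < e one := by simpa using H.orbit_pos 0
  set C₂ := C * (4 * D + 2 * D / δ) with hC₂
  have hC₂0 : 0 ≤ C₂ := by positivity
  have hest : ∀ φ n, ‖(T ^ n) φ - ℓ φ • (T ^ n) one‖ ≤ C₂ * (1 - δ) ^ n * ‖φ‖ * e ((T ^ n) one) :=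
    fun φ n => H.norm_sub_functional_smul_le hℓ φ n
  have hℓpos : ∀ φ, P φ → 0 ≤ ℓ φ := fun φ hφ =>
    ge_of_tendsto' (hℓ φ) fun n => div_nonneg (H.eval_nonneg (H.orbit_mem' n hφ))
      (H.orbit_pos n).le
  have hℓone : ℓ one = 1 := by
    refine tendsto_nhds_unique (hℓ one) (tendsto_const_nhds.congr fun n => ?_)
    rw [div_self (H.orbit_pos n).ne']
  -- If `ℓ ∘ T` is a multiple of `ℓ`, then `ℓ one = 1` forces this factor.
  set lam := ℓ (T one) with hlam
  have hlampos : 0 < lam := by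
    -- Subtracting from `T one` its allowed share of `one` stays in `P`, where `ℓ ≥ 0`; so `lam ≥ δ
    -- * (e (T one) / e one)`. The same subtraction from `T ^ n one` bounds its growth in `hcn`.
    have h1 := hℓpos _ (H.sub_mem _ _ (H.map_mem _ (H.mono _ H.one_mem)) H.one_mem hc0)
    rw [map_sub, map_smul, hℓone, smul_eq_mul, mul_one] at h1
    have h2 : 0 < e (T one) := by simpa using H.orbit_pos 1
    have : 0 < δ * (e (T one) / e one) := by positivity
    linarith
  have hsucc : ∀ n φ, (T ^ n) (T φ) = (T ^ (n + 1)) φ := fun n φ => by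
    rw [pow_succ, mul_apply_eq_comp]
  have hfun : ∀ φ, ℓ (T φ) = lam * ℓ φ := fun φ => by
    -- The ratio for `T φ` at time `n` is the ratio for `T one` at time `n` times the ratio for `φ`
    -- at time `n + 1`.
    refine tendsto_nhds_unique (hℓ (T φ)) ((Tendsto.mul (hℓ (T one))
      ((tendsto_add_atTop_iff_nat 1).2 (hℓ φ))).congr fun n => ?_)
    have := (H.orbit_pos (n + 1)).ne'
    rw [hsucc, hsucc]
    field_simp
  have hpow : ∀ n φ, ℓ ((T ^ n) φ) = lam ^ n * ℓ φ := fun n φ => by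
    induction n with
    | zero => simp
    | succ n ih =>
      rw [pow_succ', mul_apply_eq_comp, hfun, ih]
      ring
  set C₃ := e one / δ with hC₃
  have hC₃0 : 0 ≤ C₃ := by positivity
  have hcn : ∀ n, e ((T ^ n) one) ≤ C₃ * lam ^ n := fun n => by
    have h1 := hℓpos _ (H.sub_mem _ _ (H.orbit_mem n H.one_mem) H.one_mem hc0)
    rw [map_sub, map_smul, hℓone, hpow, hℓone, smul_eq_mul, mul_one, mul_one, sub_nonneg] at h1
    rw [hC₃]
    calc e ((T ^ n) one) = (e one / δ) * (δ * (e ((T ^ n) one) / e one)) := by field_simp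
      _ ≤ _ := by gcongr
  have hest' : ∀ φ n, ‖(T ^ n) φ - ℓ φ • (T ^ n) one‖
      ≤ C₂ * C₃ * ((1 - δ) ^ n * lam ^ n) * ‖φ‖ := fun φ n => by
    refine (hest φ n).trans ?_
    calc C₂ * (1 - δ) ^ n * ‖φ‖ * e ((T ^ n) one)
        ≤ C₂ * (1 - δ) ^ n * ‖φ‖ * (C₃ * lam ^ n) := by
          gcongr
          exact hcn n
      _ = _ := by ring
  -- The eigenvector is the limit of the rescaled orbit of `one`; its increments are the remainder
  -- estimate applied to `T one`, hence summable.
  set u : ℕ → E := fun n => (lam ^ n)⁻¹ • (T ^ n) one with hu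
  set C₄ := C₂ * C₃ * ‖T one‖ / lam with hC₄
  have hC₄0 : 0 ≤ C₄ := by positivity
  have hTu : ∀ n, T (u n) = lam • u (n + 1) := fun n => by
    simp only [hu]
    rw [map_smul, ← mul_apply_eq_comp, ← pow_succ', smul_smul]
    congr 1
    rw [pow_succ]
    field_simp
  have hudist : ∀ n, dist (u n) (u (n + 1)) ≤ C₄ * (1 - δ) ^ n := fun n => by
    have h1 : u (n + 1) - u n
        = (lam ^ (n + 1))⁻¹ • ((T ^ n) (T one) - ℓ (T one) • (T ^ n) one) := by
      simp only [hu]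
      rw [hsucc, smul_sub, smul_smul]
      congr 2
      rw [← hlam, pow_succ]
      field_simp
    rw [dist_comm, dist_eq_norm, h1, norm_smul, norm_inv, norm_pow,
      Real.norm_of_nonneg hlampos.le]
    calc (lam ^ (n + 1))⁻¹ * ‖(T ^ n) (T one) - ℓ (T one) • (T ^ n) one‖
        ≤ (lam ^ (n + 1))⁻¹ * (C₂ * C₃ * ((1 - δ) ^ n * lam ^ n) * ‖T one‖) := by
          gcongr
          exact hest' _ _
      _ = _ := by
          rw [hC₄, pow_succ]
          field_simp
  obtain ⟨h, hh⟩ := cauchySeq_tendsto_of_complete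
    (cauchySeq_of_le_geometric (1 - δ) C₄ hδ1 hudist)
  have hudist' : ∀ n, dist (u n) h ≤ C₄ * (1 - δ) ^ n / δ := fun n => by
    have := dist_le_of_le_geometric_of_tendsto (1 - δ) C₄ hδ1 hudist hh n
    rwa [sub_sub_cancel] at this
  refine ⟨lam, ℓ, h, ⟨hlampos, ?_, hfun, ?_, ?_⟩, ?_, hℓ⟩
  · refine tendsto_nhds_unique ((T.continuous.tendsto h).comp hh) ?_
    refine (((tendsto_add_atTop_iff_nat 1).2 hh).const_smul lam).congr fun n => ?_
    exact (hTu n).symm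
  · refine tendsto_nhds_unique ((ℓ.continuous.tendsto h).comp hh)
      (tendsto_const_nhds.congr fun n => ?_)
    simp only [hu, Function.comp_apply, map_smul, hpow, hℓone, smul_eq_mul, mul_one]
    rw [inv_mul_cancel₀ (pow_pos hlampos n).ne']
  · refine ⟨C₂ * C₃ + ‖ℓ‖ * (C₄ / δ), 1 - δ, by positivity, hδ0, hδ1, fun n φ => ?_⟩
    have e1 : (T ^ n) φ - ((lam : ℝ) ^ n * ℓ φ) • h
        = ((T ^ n) φ - ℓ φ • (T ^ n) one) + (lam ^ n * ℓ φ) • (u n - h) := by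
      simp only [hu]
      rw [smul_sub, smul_smul, mul_comm (lam ^ n) (ℓ φ), mul_assoc,
        mul_inv_cancel₀ (pow_pos hlampos n).ne', mul_one]
      abel
    simp only [RCLike.ofReal_real_eq_id, id_eq]
    rw [e1]
    refine (norm_add_le _ _).trans ?_
    rw [norm_smul, norm_mul, norm_pow, Real.norm_of_nonneg hlampos.le,
      ← dist_eq_norm (u n) h]
    calc ‖(T ^ n) φ - ℓ φ • (T ^ n) one‖ + lam ^ n * ‖ℓ φ‖ * dist (u n) h
        ≤ C₂ * C₃ * ((1 - δ) ^ n * lam ^ n) * ‖φ‖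
          + lam ^ n * (‖ℓ‖ * ‖φ‖) * (C₄ * (1 - δ) ^ n / δ) := by
          gcongr
          · exact hest' _ _
          · exact ℓ.le_opNorm φ
          · exact hudist' n
      _ = _ := by
          rw [mul_pow]
          ring
  · refine H.closed.mem_of_tendsto hh (Eventually.of_forall fun n => ?_)
    exact H.smul_mem _ _ (by positivity) (H.mono _ (H.orbit_mem n H.one_mem))

end ConeContraction

end ConeContraction

/-! ### Analytic continuation of the eigenvector. -/

section AnalyticPerturbation

variable {E G : Type*} [NormedAddCommGroup E] [NormedSpace ℝ E] [CompleteSpace E]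
  [NormedAddCommGroup G] [NormedSpace ℝ G] [CompleteSpace G]

/-- The operator is `N - lam`, where `N` is the remainder of `T` without its rank-one part, and
`lam` lies outside the disc that may contain spectrum of `N`. -/
theorem HasSpectralGap.isInvertible_remainder_sub {T : E →L[ℝ] E} {lam : ℝ} {ℓ : E →L[ℝ] ℝ}
    {h : E} (H : HasSpectralGap T lam ℓ h) :
    (T - (lam • (1 : E →L[ℝ] E) + lam • ℓ.smulRight h)).IsInvertible := by
  obtain ⟨r, hr0, hrl, hunit⟩ := H.exists_isUnit_sub_remainder
  have h1 := hunit lam (by rwa [Real.norm_of_nonneg H.pos.le])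
  have h2 := (h1.neg)
  have h3 : -(algebraMap ℝ (E →L[ℝ] E) lam - (T - ((lam : ℝ) : ℝ) • ℓ.smulRight h))
      = T - (lam • (1 : E →L[ℝ] E) + lam • ℓ.smulRight h) := by
    rw [Algebra.algebraMap_eq_smul_one]
    abel
  rw [← h3]
  obtain ⟨u, hu⟩ := h2
  exact ⟨ContinuousLinearEquiv.unitsEquiv ℝ E u, hu⟩

/-- The eigenvector of an analytic family of operators with a spectral gap at the base point
continues analytically. -/
theorem HasSpectralGap.exists_analyticAt_eigenvector {A : G → E →L[ℝ] E} {g₀ : G} {lam : ℝ}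
    {ℓ : E →L[ℝ] ℝ} {h : E} (H : HasSpectralGap (A g₀) lam ℓ h) (hA : AnalyticAt ℝ A g₀) :
    ∃ w : G → E, AnalyticAt ℝ w g₀ ∧ w g₀ = h ∧
      ∀ᶠ g in 𝓝 g₀, A g (w g) = ℓ (A g (w g)) • w g := by
  -- The term `ℓ (A g v)` stands for the unknown eigenvalue. Any zero where it is nonzero satisfies
  -- `ℓ v = 1`, so the equation carries its own normalization and its derivative in `v` is
  -- invertible at `h`.
  set F : G × E → E := fun p => A p.1 p.2 - ℓ (A p.1 p.2) • p.2 with hF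
  have hA1 : AnalyticAt ℝ (fun p : G × E => A p.1) (g₀, h) :=
    AnalyticAt.comp (f := Prod.fst) (x := (g₀, h)) hA analyticAt_fst
  have hA2 : AnalyticAt ℝ (fun p : G × E => A p.1 p.2) (g₀, h) := 
    (ContinuousLinearMap.id ℝ (E →L[ℝ] E)).analyticAt_bilinear _ |>.comp (hA1.prod analyticAt_snd)
  have hA3 : AnalyticAt ℝ (fun p : G × E => ℓ (A p.1 p.2)) (g₀, h) :=
    (ℓ.analyticAt _).comp hA2
  have hFan : AnalyticAt ℝ F (g₀, h) := hA2.sub (hA3.smul analyticAt_snd)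
  -- Here `⊤` is the analytic smoothness class, so the implicit function is analytic and not merely
  -- smooth.
  have hFcd : ContDiffAt ℝ (⊤ : WithTop ℕ∞) F (g₀, h) := hFan.contDiffAt
  have hF0 : F (g₀, h) = 0 := by
    have := H.map_functional h
    have h1 := H.map_eigenvector
    rw [H.normalized, mul_one] at this
    simp only [hF]
    rw [this, h1, sub_self]
  have hder : fderiv ℝ F (g₀, h) ∘L .inr ℝ G E
      = A g₀ - (lam • (1 : E →L[ℝ] E) + lam • ℓ.smulRight h) := by
    have h1 : HasFDerivAt (fun v : E => F (g₀, v)) (fderiv ℝ F (g₀, h) ∘L .inr ℝ G E) h :=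
      HasFDerivAt.comp (f := fun v : E => (g₀, v)) h hFan.differentiableAt.hasFDerivAt
        (hasFDerivAt_prodMk_right g₀ h)
    have h2 : HasFDerivAt (fun v : E => F (g₀, v))
        (A g₀ - (ℓ (A g₀ h) • (ContinuousLinearMap.id ℝ E) + (ℓ ∘L A g₀).smulRight h)) h :=
      (A g₀).hasFDerivAt.sub (((ℓ ∘L A g₀).hasFDerivAt).smul (hasFDerivAt_id h))
    rw [h1.unique h2]
    ext v
    have := H.map_functional h
    rw [H.normalized, mul_one] at this
    simp only [sub_apply, add_apply, smul_apply, ContinuousLinearMap.smulRight_apply,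
      ContinuousLinearMap.comp_apply, H.map_functional, smul_smul]
    rw [H.normalized]
    simp
  have hinv : (fderiv ℝ F (g₀, h) ∘L .inr ℝ G E).IsInvertible := by
    rw [hder]
    exact H.isInvertible_remainder_sub
  have hne : (⊤ : WithTop ℕ∞) ≠ 0 := by simp
  refine ⟨hFcd.implicitFunction hne hinv, ?_, hFcd.implicitFunction_apply_self hne hinv, ?_⟩
  · exact (hFcd.contDiffAt_implicitFunction hne hinv).analyticAt
  · filter_upwards [hFcd.eventually_apply_implicitFunction hne hinv] with g hg
    rw [hF0] at hg
    exact sub_eq_zero.1 hg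

end AnalyticPerturbation

/-! ### Hölder functions: completeness, products, exponentials, complexification. -/

noncomputable section HolderBasics

namespace HolderSpace

variable {M : Type*} [MetricSpace M] [CompactSpace M] {γ : ℝ≥0} {𝕜 : Type*} [RCLike 𝕜]

/-- A Hölder function from an explicit Hölder bound. -/
def ofBound (g : (ℕ → M) → 𝕜) (hg : Continuous g) (C : ℝ≥0)
    (h : ∀ x y, ‖g x - g y‖ ≤ C * dist x y ^ (γ : ℝ)) : HolderSpace M γ 𝕜 :=
  (⟨⟨g, hg⟩, (holderWith_of_norm_sub_le h).memHolder⟩ : ↥(holderSubmodule M γ 𝕜))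

@[simp] theorem ofBound_apply (g : (ℕ → M) → 𝕜) (hg : Continuous g) (C : ℝ≥0)
    (h : ∀ x y, ‖g x - g y‖ ≤ C * dist x y ^ (γ : ℝ)) (x : ℕ → M) :
    ofBound g hg C h x = g x := rfl

@[ext] theorem ext {f g : HolderSpace M γ 𝕜} (h : ∀ x, f x = g x) : f = g := DFunLike.ext _ _ h

@[simp] theorem add_apply' (f g : HolderSpace M γ 𝕜) (x : ℕ → M) : (f + g) x = f x + g x := rfl

@[simp] theorem sub_apply' (f g : HolderSpace M γ 𝕜) (x : ℕ → M) : (f - g) x = f x - g x := rfl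

@[simp] theorem zero_apply' (x : ℕ → M) : (0 : HolderSpace M γ 𝕜) x = 0 := rfl

@[simp] theorem smul_apply' (c : 𝕜) (f : HolderSpace M γ 𝕜) (x : ℕ → M) :
    (c • f) x = c * f x := rfl

theorem norm_toCont_le (f : HolderSpace M γ 𝕜) : ‖f.toCont‖ ≤ ‖f‖ := by
  rw [norm_def]
  exact le_add_of_nonneg_right (NNReal.coe_nonneg _)

theorem norm_coe_le (f : HolderSpace M γ 𝕜) (x : ℕ → M) : ‖f x‖ ≤ ‖f‖ :=
  (f.norm_apply_le x).trans f.norm_toCont_le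

theorem nnHolderNorm_le (f : HolderSpace M γ 𝕜) : (nnHolderNorm γ f : ℝ) ≤ ‖f‖ := by
  rw [norm_def]
  exact le_add_of_nonneg_left (norm_nonneg _)

theorem norm_sub_le_norm_mul (f : HolderSpace M γ 𝕜) (x y : ℕ → M) :
    ‖f x - f y‖ ≤ ‖f‖ * dist x y ^ (γ : ℝ) :=
  (f.norm_sub_le x y).trans (by gcongr; exact f.nnHolderNorm_le)

theorem norm_le_add (f : HolderSpace M γ 𝕜) {A B : ℝ} (hA : 0 ≤ A) (hB : 0 ≤ B)
    (h1 : ∀ x, ‖f x‖ ≤ A) (h2 : ∀ x y, ‖f x - f y‖ ≤ B * dist x y ^ (γ : ℝ)) :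
    ‖f‖ ≤ A + B := by
  rw [norm_def]
  refine add_le_add ((ContinuousMap.norm_le _ hA).2 h1) ?_
  lift B to ℝ≥0 using hB
  exact NNReal.coe_le_coe.2 (holderWith_of_norm_sub_le h2).nnholderNorm_le

/-- A Cauchy sequence converges uniformly, and the Cauchy bounds on increments pass to the pointwise
limit. -/
instance : CompleteSpace (HolderSpace M γ 𝕜) := by
  refine Metric.complete_of_cauchySeq_tendsto fun u hu => ?_
  have hc : CauchySeq fun n => (u n).toCont := by
    rw [Metric.cauchySeq_iff'] at hu ⊢
    intro ε hε
    obtain ⟨N, hN⟩ := hu ε hε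
    refine ⟨N, fun n hn => (hN n hn).trans_le' ?_⟩
    rw [dist_eq_norm, dist_eq_norm]
    exact norm_toCont_le (u n - u N)
  obtain ⟨g, hg⟩ := cauchySeq_tendsto_of_complete hc
  have hgx : ∀ x, Tendsto (fun n => u n x) atTop (𝓝 (g x)) := fun x =>
    ((continuous_eval_const (F := C(ℕ → M, 𝕜)) x).tendsto g).comp hg
  rw [Metric.cauchySeq_iff'] at hu
  have key : ∀ ε > 0, ∃ N, ∀ n ≥ N,
      (∀ x, ‖u n x - g x‖ ≤ ε) ∧
        ∀ x y, ‖(u n x - g x) - (u n y - g y)‖ ≤ ε * dist x y ^ (γ : ℝ) := by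
    intro ε hε
    obtain ⟨N, hN⟩ := hu (ε / 2) (half_pos hε)
    have hnm : ∀ n ≥ N, ∀ m ≥ N, ‖u n - u m‖ ≤ ε := fun n hn m hm => by
      rw [← dist_eq_norm]
      have h1 := hN n hn
      have h2 := hN m hm
      have := dist_triangle_right (u n) (u m) (u N)
      linarith
    refine ⟨N, fun n hn => ⟨fun x => ?_, fun x y => ?_⟩⟩
    · refine le_of_tendsto ((tendsto_const_nhds.sub (hgx x)).norm) ?_
      filter_upwards [eventually_ge_atTop N] with m hm
      exact ((u n - u m).norm_coe_le x).trans (hnm n hn m hm)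
    · refine le_of_tendsto
        (((tendsto_const_nhds.sub (hgx x)).sub (tendsto_const_nhds.sub (hgx y))).norm) ?_
      filter_upwards [eventually_ge_atTop N] with m hm
      refine ((u n - u m).norm_sub_le_norm_mul x y).trans ?_
      gcongr
      exact hnm n hn m hm
  obtain ⟨N, hN⟩ := key 1 one_pos
  let G : HolderSpace M γ 𝕜 := ofBound g g.continuous (1 + nnHolderNorm γ (u N)) fun x y => by
    have h1 := (hN N le_rfl).2 x y
    have h2 := (u N).norm_sub_le x y
    have h3 : g x - g y = (u N x - u N y) - ((u N x - g x) - (u N y - g y)) := by ring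
    rw [h3, NNReal.coe_add, NNReal.coe_one, add_mul]
    refine (_root_.norm_sub_le _ _).trans ?_
    linarith
  refine ⟨G, Metric.tendsto_atTop.2 fun ε hε => ?_⟩
  obtain ⟨N, hN⟩ := key (ε / 3) (by positivity)
  refine ⟨N, fun n hn => ?_⟩
  rw [dist_eq_norm]
  have := norm_le_add (u n - G) (by positivity) (by positivity) (hN n hn).1 (hN n hn).2
  linarith

/-- Evaluation at a point as a bounded functional. -/
def evalCLM (x : ℕ → M) : HolderSpace M γ 𝕜 →L[𝕜] 𝕜 :=
  LinearMap.mkContinuous ⟨⟨fun f => f x, fun _ _ => rfl⟩, fun _ _ => rfl⟩ 1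
    fun f => by rw [one_mul]; exact f.norm_coe_le x

@[simp] theorem evalCLM_apply (x : ℕ → M) (f : HolderSpace M γ 𝕜) : evalCLM x f = f x := rfl

/-- Constant functions. -/
def const (M : Type*) [MetricSpace M] [CompactSpace M] (γ : ℝ≥0) (c : 𝕜) : HolderSpace M γ 𝕜 :=
  ofBound (fun _ => c) continuous_const 0 fun x y => by simp

@[simp] theorem const_apply (c : 𝕜) (x : ℕ → M) : const M γ c x = c := rfl

/-- The product of two Hölder functions. -/
def mul (f g : HolderSpace M γ 𝕜) : HolderSpace M γ 𝕜 :=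
  ofBound (fun x => f x * g x) (f.continuous.mul g.continuous) (‖f‖₊ * ‖g‖₊ + ‖f‖₊ * ‖g‖₊)
    fun x y => by
      have e : f x * g x - f y * g y = (f x - f y) * g x + f y * (g x - g y) := by ring
      rw [e]
      refine (norm_add_le _ _).trans ?_
      rw [norm_mul, norm_mul]
      have h1 := f.norm_sub_le_norm_mul x y
      have h2 := g.norm_sub_le_norm_mul x y
      have h3 := f.norm_coe_le y
      have h4 := g.norm_coe_le x
      calc ‖f x - f y‖ * ‖g x‖ + ‖f y‖ * ‖g x - g y‖
          ≤ ‖f‖ * dist x y ^ (γ : ℝ) * ‖g‖ + ‖f‖ * (‖g‖ * dist x y ^ (γ : ℝ)) := by gcongr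
        _ = _ := by
          push_cast
          ring

@[simp] theorem mul_apply (f g : HolderSpace M γ 𝕜) (x : ℕ → M) : f.mul g x = f x * g x := rfl

theorem norm_mul_le' (f g : HolderSpace M γ 𝕜) : ‖f.mul g‖ ≤ 3 * ‖f‖ * ‖g‖ := by
  have h1 : ∀ x, ‖f.mul g x‖ ≤ ‖f‖ * ‖g‖ := fun x => by
    rw [mul_apply, norm_mul]
    exact mul_le_mul (f.norm_coe_le x) (g.norm_coe_le x) (norm_nonneg _) (norm_nonneg _)
  have h2 : ∀ x y, ‖f.mul g x - f.mul g y‖ ≤ 2 * (‖f‖ * ‖g‖) * dist x y ^ (γ : ℝ) := fun x y => by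
    have e : f.mul g x - f.mul g y = (f x - f y) * g x + f y * (g x - g y) := by
      simp only [mul_apply]
      ring
    rw [e]
    refine (norm_add_le _ _).trans ?_
    rw [norm_mul, norm_mul]
    have h1 := f.norm_sub_le_norm_mul x y
    have h2 := g.norm_sub_le_norm_mul x y
    have h3 := f.norm_coe_le y
    have h4 := g.norm_coe_le x
    calc ‖f x - f y‖ * ‖g x‖ + ‖f y‖ * ‖g x - g y‖
        ≤ ‖f‖ * dist x y ^ (γ : ℝ) * ‖g‖ + ‖f‖ * (‖g‖ * dist x y ^ (γ : ℝ)) := by gcongr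
      _ = _ := by ring
  have := norm_le_add (f.mul g) (by positivity) (by positivity) h1 h2
  linarith

/-- Multiplication as a bounded bilinear map. -/
def mulCLM (M : Type*) [MetricSpace M] [CompactSpace M] (γ : ℝ≥0) (𝕜 : Type*) [RCLike 𝕜] :
    HolderSpace M γ 𝕜 →L[𝕜] HolderSpace M γ 𝕜 →L[𝕜] HolderSpace M γ 𝕜 :=
  LinearMap.mkContinuous₂
    (LinearMap.mk₂ 𝕜 mul
      (fun f g φ => by ext x; simp [add_mul])
      (fun c f φ => by ext x; simp [mul_assoc])
      (fun f g φ => by ext x; simp [mul_add])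
      (fun c f φ => by ext x; simp [mul_left_comm])) 3 norm_mul_le'

@[simp] theorem mulCLM_apply (f g : HolderSpace M γ 𝕜) (x : ℕ → M) :
    mulCLM M γ 𝕜 f g x = f x * g x := rfl

/-- Multiplication by `exp f`. -/
def mulExp (f : HolderSpace M γ ℝ) : HolderSpace M γ ℝ →L[ℝ] HolderSpace M γ ℝ :=
  NormedSpace.exp (mulCLM M γ ℝ f)

-- Evaluating the operator exponential series at `φ` and at `x` is continuous and gives the scalar
-- series for `Real.exp (f x)`.
@[simp] theorem mulExp_apply (f φ : HolderSpace M γ ℝ) (x : ℕ → M) :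
    mulExp f φ x = Real.exp (f x) * φ x := by
  have h1 := NormedSpace.exp_series_hasSum_exp' (𝕂 := ℝ) (mulCLM M γ ℝ f)
  have h2 := ((evalCLM (𝕜 := ℝ) (γ := γ) x) ∘L
    (ContinuousLinearMap.apply ℝ (HolderSpace M γ ℝ) φ)).hasSum h1
  have h3 := (NormedSpace.exp_series_hasSum_exp' (𝕂 := ℝ) (f x)).mul_right (φ x)
  rw [← Real.exp_eq_exp_ℝ] at h3
  have h4 : ∀ n : ℕ, ((mulCLM M γ ℝ f) ^ n) φ x = f x ^ n * φ x := fun n => by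
    induction n with
    | zero => simp
    | succ n ih =>
      rw [pow_succ', mul_apply_eq_comp, mulCLM_apply, ih]
      ring
  simp only [ContinuousLinearMap.comp_apply, map_smul, ContinuousLinearMap.apply_apply,
    evalCLM_apply, h4, smul_eq_mul] at h2
  simp only [smul_eq_mul, mul_assoc] at h3
  exact h2.unique h3

/-- Taking the exponential in the operator algebra reduces this to analyticity of `exp` on a Banach
algebra, composed with a bounded linear map. -/
theorem analyticAt_mulExp (f : HolderSpace M γ ℝ) :
    AnalyticAt ℝ (mulExp : HolderSpace M γ ℝ → _) f :=
  (NormedSpace.exp_analytic (𝕂 := ℝ) (mulCLM M γ ℝ f)).comp ((mulCLM M γ ℝ).analyticAt f)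

/-- The exponential of a Hölder function. -/
def exp (f : HolderSpace M γ ℝ) : HolderSpace M γ ℝ := mulExp f (const M γ 1)

@[simp] theorem exp_apply (f : HolderSpace M γ ℝ) (x : ℕ → M) : exp f x = Real.exp (f x) := by
  simp [exp]

/-- Real part. -/
def re (φ : HolderSpace M γ ℂ) : HolderSpace M γ ℝ :=
  ofBound (fun x => (φ x).re) (Complex.continuous_re.comp φ.continuous) (nnHolderNorm γ φ)
    fun x y => by
      rw [← Complex.sub_re]
      exact (Complex.abs_re_le_norm _).trans (φ.norm_sub_le x y)

/-- Imaginary part. -/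
def im (φ : HolderSpace M γ ℂ) : HolderSpace M γ ℝ :=
  ofBound (fun x => (φ x).im) (Complex.continuous_im.comp φ.continuous) (nnHolderNorm γ φ)
    fun x y => by
      rw [← Complex.sub_im]
      exact (Complex.abs_im_le_norm _).trans (φ.norm_sub_le x y)

/-- A real function as a complex one. -/
def toComplex (φ : HolderSpace M γ ℝ) : HolderSpace M γ ℂ :=
  ofBound (fun x => (φ x : ℂ)) (Complex.continuous_ofReal.comp φ.continuous) (nnHolderNorm γ φ)
    fun x y => by
      rw [← Complex.ofReal_sub, Complex.norm_real]
      exact φ.norm_sub_le x y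

@[simp] theorem re_apply (φ : HolderSpace M γ ℂ) (x : ℕ → M) : re φ x = (φ x).re := rfl

@[simp] theorem im_apply (φ : HolderSpace M γ ℂ) (x : ℕ → M) : im φ x = (φ x).im := rfl

@[simp] theorem toComplex_apply (φ : HolderSpace M γ ℝ) (x : ℕ → M) :
    toComplex φ x = (φ x : ℂ) := rfl

theorem norm_re_le (φ : HolderSpace M γ ℂ) : ‖re φ‖ ≤ ‖φ‖ := by
  refine (norm_le_add (re φ) (norm_nonneg φ.toCont) (NNReal.coe_nonneg (nnHolderNorm γ φ))
    (fun x => (Complex.abs_re_le_norm _).trans (φ.norm_apply_le x)) fun x y => ?_)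
  rw [re_apply, re_apply, ← Complex.sub_re]
  exact (Complex.abs_re_le_norm _).trans (φ.norm_sub_le x y)

theorem norm_im_le (φ : HolderSpace M γ ℂ) : ‖im φ‖ ≤ ‖φ‖ := by
  refine (norm_le_add (im φ) (norm_nonneg φ.toCont) (NNReal.coe_nonneg (nnHolderNorm γ φ))
    (fun x => (Complex.abs_im_le_norm _).trans (φ.norm_apply_le x)) fun x y => ?_)
  rw [im_apply, im_apply, ← Complex.sub_im]
  exact (Complex.abs_im_le_norm _).trans (φ.norm_sub_le x y)

theorem norm_toComplex_le (φ : HolderSpace M γ ℝ) : ‖toComplex φ‖ ≤ ‖φ‖ := by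
  refine (norm_le_add (toComplex φ) (norm_nonneg φ.toCont)
    (NNReal.coe_nonneg (nnHolderNorm γ φ)) (fun x => ?_) fun x y => ?_)
  · rw [toComplex_apply, Complex.norm_real]
    exact φ.norm_apply_le x
  · rw [toComplex_apply, toComplex_apply, ← Complex.ofReal_sub, Complex.norm_real]
    exact φ.norm_sub_le x y

theorem toComplex_re_add_im (φ : HolderSpace M γ ℂ) :
    toComplex (re φ) + Complex.I • toComplex (im φ) = φ := by
  ext x
  simp only [add_apply', smul_apply', toComplex_apply, re_apply, im_apply]
  rw [mul_comm, Complex.re_add_im]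

/-- The complexification of a bounded functional. -/
def complexify (ℓ : HolderSpace M γ ℝ →L[ℝ] ℝ) : HolderSpace M γ ℂ →L[ℂ] ℂ :=
  LinearMap.mkContinuous
    ⟨⟨fun φ => (ℓ (re φ) : ℂ) + ℓ (im φ) * Complex.I, fun φ ψ => by
      have h1 : re (φ + ψ) = re φ + re ψ := by ext x; simp
      have h2 : im (φ + ψ) = im φ + im ψ := by ext x; simp
      rw [h1, h2, map_add, map_add]
      push_cast
      ring⟩, fun c φ => by
      have h1 : re (c • φ) = c.re • re φ - c.im • im φ := by ext x; simp
      have h2 : im (c • φ) = c.re • im φ + c.im • re φ := by ext x; simp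
      simp only [h1, h2, map_add, map_sub, map_smul, smul_eq_mul, RingHom.id_apply]
      apply Complex.ext <;> simp⟩ (‖ℓ‖ + ‖ℓ‖) fun φ => by
      refine (norm_add_le _ _).trans ?_
      rw [norm_mul, Complex.norm_I, mul_one, Complex.norm_real, Complex.norm_real, add_mul]
      exact add_le_add (ℓ.le_opNorm_of_le (norm_re_le φ)) (ℓ.le_opNorm_of_le (norm_im_le φ))

theorem complexify_apply (ℓ : HolderSpace M γ ℝ →L[ℝ] ℝ) (φ : HolderSpace M γ ℂ) :
    complexify ℓ φ = (ℓ (re φ) : ℂ) + ℓ (im φ) * Complex.I := rfl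

end HolderSpace

open HolderSpace

variable {M : Type*} [MetricSpace M] [CompactSpace M] {γ : ℝ≥0}

/-- A spectral gap over the reals passes to the complexified operator. -/
theorem HasSpectralGap.complexify {T : HolderSpace M γ ℝ →L[ℝ] HolderSpace M γ ℝ}
    {S : HolderSpace M γ ℂ →L[ℂ] HolderSpace M γ ℂ}
    (hTS : ∀ φ, S (toComplex φ) = toComplex (T φ)) {lam : ℝ}
    {ℓ : HolderSpace M γ ℝ →L[ℝ] ℝ} {h : HolderSpace M γ ℝ} (H : HasSpectralGap T lam ℓ h) :
    HasSpectralGap S lam (HolderSpace.complexify ℓ) (toComplex h) := by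
  have hpow : ∀ n φ, (S ^ n) (toComplex φ) = toComplex ((T ^ n) φ) := fun n φ => by
    induction n with
    | zero => rfl
    | succ n ih =>
      rw [pow_succ', mul_apply_eq_comp, ih, hTS, pow_succ', mul_apply_eq_comp]
  have hsplit : ∀ n φ, (S ^ n) φ
      = toComplex ((T ^ n) (re φ)) + Complex.I • toComplex ((T ^ n) (im φ)) := fun n φ => by
    conv_lhs => rw [← toComplex_re_add_im φ]
    rw [map_add, map_smul, hpow, hpow]
  refine ⟨H.pos, ?_, fun φ => ?_, ?_, ?_⟩
  · rw [hTS, H.map_eigenvector]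
    ext x
    exact Complex.ofReal_mul lam (h x)
  · have h1 := hsplit 1 φ
    rw [pow_one, pow_one] at h1
    have h2 : re (S φ) = T (re φ) := by
      rw [h1]
      ext x
      simp
    have h3 : im (S φ) = T (im φ) := by
      rw [h1]
      ext x
      simp
    rw [complexify_apply, h2, h3, H.map_functional, H.map_functional, complexify_apply]
    push_cast
    simp only [RCLike.ofReal_real_eq_id, id_eq, Complex.coe_algebraMap]
    ring
  · have h1 : re (toComplex h) = h := by ext x; simp
    have h2 : im (toComplex h) = 0 := by ext x; simp
    rw [complexify_apply, h1, h2, H.normalized]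
    simp
  · obtain ⟨C, ρ, hC, hρ0, hρ1, hdec⟩ := H.decay
    refine ⟨C + C, ρ, by positivity, hρ0, hρ1, fun n φ => ?_⟩
    have e : (S ^ n) φ - ((lam : ℂ) ^ n * HolderSpace.complexify ℓ φ) • toComplex h
        = toComplex ((T ^ n) (re φ) - (lam ^ n * ℓ (re φ)) • h)
          + Complex.I • toComplex ((T ^ n) (im φ) - (lam ^ n * ℓ (im φ)) • h) := by
      rw [hsplit]
      ext x
      simp only [complexify_apply, add_apply', sub_apply', smul_apply', toComplex_apply]
      push_cast
      ring
    change ‖(S ^ n) φ - ((lam : ℂ) ^ n * HolderSpace.complexify ℓ φ) • toComplex h‖ ≤ _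
    rw [e]
    refine (norm_add_le _ _).trans ?_
    rw [norm_smul, Complex.norm_I, one_mul]
    have hlam := H.pos
    calc _ ≤ C * (ρ * lam) ^ n * ‖re φ‖ + C * (ρ * lam) ^ n * ‖im φ‖ :=
          add_le_add ((norm_toComplex_le _).trans (hdec n _))
            ((norm_toComplex_le _).trans (hdec n _))
      _ ≤ C * (ρ * lam) ^ n * ‖φ‖ + C * (ρ * lam) ^ n * ‖φ‖ := by
          gcongr
          · exact norm_re_le φ
          · exact norm_im_le φ
      _ = _ := by ring

end HolderBasics

/-! ### The invariant cone of the Ruelle operator and Ruelle's theorem. -/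

section RuelleCone

open HolderSpace

variable {M : Type*} [MetricSpace M] [CompactSpace M] {γ : ℝ≥0}

/-- Nonnegative functions whose logarithm is Hölder with constant `K`. -/
def holderCone (K : ℝ) (φ : HolderSpace M γ ℝ) : Prop :=
  (∀ x, 0 ≤ φ x) ∧ ∀ x y, φ x ≤ Real.exp (K * dist x y ^ (γ : ℝ)) * φ y

theorem exists_dist_rpow_le (M : Type*) [MetricSpace M] [CompactSpace M] (γ : ℝ≥0) :
    ∃ B : ℝ, 0 ≤ B ∧ ∀ x y : ℕ → M, dist x y ^ (γ : ℝ) ≤ B :=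
  ⟨Metric.diam (univ : Set (ℕ → M)) ^ (γ : ℝ), Real.rpow_nonneg Metric.diam_nonneg _,
    fun x y => Real.rpow_le_rpow dist_nonneg
      (Metric.dist_le_diam_of_mem isCompact_univ.isBounded (mem_univ x) (mem_univ y))
      γ.coe_nonneg⟩

theorem dist_consSeq_rpow (a : M) (x y : ℕ → M) :
    dist (consSeq a x) (consSeq a y) ^ (γ : ℝ)
      = (1 / 2 : ℝ) ^ (γ : ℝ) * dist x y ^ (γ : ℝ) := by
  rw [dist_consSeq, Real.mul_rpow (by norm_num) dist_nonneg]

namespace holderCone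

theorem mono {K K' : ℝ} (hK : K' ≤ K) {φ : HolderSpace M γ ℝ} (h : holderCone K' φ) :
    holderCone K φ := by
  refine ⟨h.1, fun x y => (h.2 x y).trans ?_⟩
  have := h.1 y
  gcongr

theorem smul {K c : ℝ} (hc : 0 ≤ c) {φ : HolderSpace M γ ℝ} (h : holderCone K φ) :
    holderCone K (c • φ) := by
  refine ⟨fun x => mul_nonneg hc (h.1 x), fun x y => ?_⟩
  rw [smul_apply', smul_apply', mul_left_comm]
  exact mul_le_mul_of_nonneg_left (h.2 x y) hc

theorem isClosed (K : ℝ) : IsClosed {φ : HolderSpace M γ ℝ | holderCone K φ} := by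
  have hc : ∀ x, Continuous fun φ : HolderSpace M γ ℝ => φ x := fun x =>
    (evalCLM (𝕜 := ℝ) (γ := γ) x).continuous
  refine IsClosed.inter (s₁ := {φ : HolderSpace M γ ℝ | ∀ x, 0 ≤ φ x}) ?_ ?_
  · simp only [ofPred_forall]
    exact isClosed_iInter fun x => isClosed_le continuous_const (hc x)
  · change IsClosed {φ : HolderSpace M γ ℝ |
      ∀ x y, φ x ≤ Real.exp (K * dist x y ^ (γ : ℝ)) * φ y}
    simp only [ofPred_forall]
    exact isClosed_iInter fun x => isClosed_iInter fun y =>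
      isClosed_le (hc x) (continuous_const.mul (hc y))

theorem const_one {K : ℝ} (hK : 0 ≤ K) : holderCone K (const M γ (1 : ℝ)) :=
  ⟨fun _ => zero_le_one, fun x y => by
    rw [const_apply, const_apply, mul_one]
    exact Real.one_le_exp (by positivity)⟩

/-- A Harnack inequality: all values of a cone element are comparable. -/
theorem le_exp_mul {K B : ℝ} (hK : 0 ≤ K) (hB : ∀ x y : ℕ → M, dist x y ^ (γ : ℝ) ≤ B)
    {φ : HolderSpace M γ ℝ} (h : holderCone K φ) (x y : ℕ → M) :
    φ x ≤ Real.exp (K * B) * φ y := by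
  refine (h.2 x y).trans ?_
  have := h.1 y
  have := hB x y
  gcongr

theorem norm_le {K B : ℝ} (hK : 0 ≤ K) (hB : ∀ x y : ℕ → M, dist x y ^ (γ : ℝ) ≤ B)
    {φ : HolderSpace M γ ℝ} (h : holderCone K φ) (x₀ : ℕ → M) :
    ‖φ‖ ≤ (Real.exp (K * B) + K * Real.exp (K * B) ^ 2) * φ x₀ := by
  have h0 := h.1 x₀
  have hsub : ∀ x y, φ x - φ y ≤ K * Real.exp (K * B) ^ 2 * φ x₀ * dist x y ^ (γ : ℝ) := by
    intro x y
    have h1 := h.2 x y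
    have h2 := h.le_exp_mul hK hB y x₀
    set d := dist x y ^ (γ : ℝ) with hd
    have hd0 : 0 ≤ d := by positivity
    have h3 : Real.exp (K * d) - 1 ≤ K * d * Real.exp (K * B) := by
      have e1 := Real.add_one_le_exp (-(K * d))
      have e2 : Real.exp (K * d) ≤ Real.exp (K * B) := by
        have := hB x y
        gcongr
      have e3 : Real.exp (K * d) * Real.exp (-(K * d)) = 1 := by
        rw [← Real.exp_add, add_neg_cancel, Real.exp_zero]
      have e4 := mul_le_mul_of_nonneg_left e1 (Real.exp_pos (K * d)).le
      have e5 := mul_le_mul_of_nonneg_left e2 (mul_nonneg hK hd0)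
      linarith
    calc φ x - φ y ≤ (Real.exp (K * d) - 1) * φ y := by linarith
      _ ≤ (K * d * Real.exp (K * B)) * (Real.exp (K * B) * φ x₀) := by
          have := h.1 y
          gcongr
      _ = _ := by ring
  have := norm_le_add φ (A := Real.exp (K * B) * φ x₀) (B := K * Real.exp (K * B) ^ 2 * φ x₀)
    (by positivity) (by positivity)
    (fun x => by
      rw [Real.norm_of_nonneg (h.1 x)]
      exact h.le_exp_mul hK hB x x₀)
    (fun x y => by
      rw [Real.norm_eq_abs, abs_le]
      have h1 := hsub x y
      have h2 := hsub y x
      rw [dist_comm] at h2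
      constructor <;> linarith)
  linarith

/-- The shifted function is at least `‖φ‖`, which bounds its Hölder constant. Its values at two
points thus differ by a factor at most `1 + d ≤ exp (K * d)`; this is the source of the constant `2`
in `exists_coneContraction`. -/
theorem add_const {K : ℝ} (hK : 1 ≤ K) (φ : HolderSpace M γ ℝ) :
    holderCone K (φ + (2 * ‖φ‖) • const M γ (1 : ℝ)) := by
  have hb : ∀ x, |φ x| ≤ ‖φ‖ := fun x => φ.norm_coe_le x
  refine ⟨fun x => ?_, fun x y => ?_⟩
  · simp only [add_apply', smul_apply', const_apply, mul_one]
    have := (abs_le.1 (hb x)).1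
    linarith [norm_nonneg φ]
  · simp only [add_apply', smul_apply', const_apply, mul_one]
    have h1 := (abs_le.1 (hb y)).1
    have h2 := (le_abs_self _).trans (φ.norm_sub_le_norm_mul x y)
    set d := dist x y ^ (γ : ℝ) with hd
    have hd0 : 0 ≤ d := by positivity
    have h3 := Real.add_one_le_exp (K * d)
    have h4 : 1 + d ≤ Real.exp (K * d) := by nlinarith
    calc φ x + 2 * ‖φ‖ ≤ φ y + 2 * ‖φ‖ + d * ‖φ‖ := by linarith
      _ ≤ φ y + 2 * ‖φ‖ + d * (φ y + 2 * ‖φ‖) := by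
          gcongr
          linarith
      _ = (1 + d) * (φ y + 2 * ‖φ‖) := by ring
      _ ≤ _ := by
          gcongr
          linarith [norm_nonneg φ]

/-- Passing from `K - 1` to `K` leaves room at least `φ y * d`, while subtracting `t • χ` costs at
most `t * χ y` times a multiple of `d`. The Harnack inequality, applied to both functions, gives `t
* χ y ≤ δ * C ^ 2 * φ y`, so a small `δ` suffices. -/
theorem sub_smul {K B δ : ℝ} (hK : 1 ≤ K) (hB : ∀ x y : ℕ → M, dist x y ^ (γ : ℝ) ≤ B)
    (hδ0 : 0 ≤ δ) (hδ : δ * (Real.exp ((K - 1) * B) ^ 2 * (Real.exp (K * B) * (2 * K))) ≤ 1)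
    (hδ' : δ * Real.exp ((K - 1) * B) ^ 2 ≤ 1)
    {φ χ : HolderSpace M γ ℝ} (hφ : holderCone (K - 1) φ) (hχ : holderCone (K - 1) χ)
    {x₀ : ℕ → M} (h0 : 0 < χ x₀) : holderCone K (φ - (δ * (φ x₀ / χ x₀)) • χ) := by
  have hK' : 0 ≤ K - 1 := by linarith
  set C := Real.exp ((K - 1) * B) with hC
  have hC0 : 0 < C := Real.exp_pos _
  set t := δ * (φ x₀ / χ x₀) with ht
  have ht0 : 0 ≤ t := mul_nonneg hδ0 (div_nonneg (hφ.1 x₀) h0.le)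
  have htχ : ∀ y, t * χ y ≤ δ * C ^ 2 * φ y := fun y => by
    have h1 := hχ.le_exp_mul hK' hB y x₀
    have h2 := hφ.le_exp_mul hK' hB x₀ y
    rw [← hC] at h1 h2
    calc t * χ y ≤ t * (C * χ x₀) := by gcongr
      _ = δ * C * φ x₀ := by rw [ht]; field_simp
      _ ≤ δ * C * (C * φ y) := by gcongr
      _ = _ := by ring
  refine ⟨fun x => ?_, fun x y => ?_⟩
  · rw [sub_apply', smul_apply']
    have h1 := htχ x
    have h2 := mul_le_mul_of_nonneg_right hδ' (hφ.1 x)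
    linarith
  · simp only [sub_apply', smul_apply']
    have h1 := hφ.2 x y
    have h2 := hχ.2 y x
    have h3 := htχ y
    have hd1 := hB x y
    rw [dist_comm] at h2
    set d := dist x y ^ (γ : ℝ) with hd
    have hd0 : 0 ≤ d := by positivity
    have hφy := hφ.1 y
    have hχy := hχ.1 y
    have e1 : Real.exp ((K - 1) * d) * Real.exp (-((K - 1) * d)) = 1 := by
      rw [← Real.exp_add, add_neg_cancel, Real.exp_zero]
    have h4 : Real.exp (-((K - 1) * d)) * χ y ≤ χ x := by
      calc Real.exp (-((K - 1) * d)) * χ y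
          ≤ Real.exp (-((K - 1) * d)) * (Real.exp ((K - 1) * d) * χ x) := by gcongr
        _ = (Real.exp ((K - 1) * d) * Real.exp (-((K - 1) * d))) * χ x := by ring
        _ = χ x := by rw [e1, one_mul]
    have h5 : Real.exp (K * d) - Real.exp (-((K - 1) * d))
        ≤ Real.exp (K * B) * (2 * K) * d := by
      have a1 := Real.add_one_le_exp (-((K - 1) * d) - K * d)
      have a2 : Real.exp (-((K - 1) * d))
          = Real.exp (K * d) * Real.exp (-((K - 1) * d) - K * d) := by
        rw [← Real.exp_add]
        ring_nf
      have a3 : Real.exp (K * d) ≤ Real.exp (K * B) := by gcongr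
      calc Real.exp (K * d) - Real.exp (-((K - 1) * d))
          = Real.exp (K * d) * (1 - Real.exp (-((K - 1) * d) - K * d)) := by rw [a2]; ring
        _ ≤ Real.exp (K * d) * ((2 * K) * d) := by
            gcongr
            linarith
        _ ≤ Real.exp (K * B) * ((2 * K) * d) := by gcongr
        _ = _ := by ring
    have h6 : d ≤ Real.exp (K * d) - Real.exp ((K - 1) * d) := by
      have a1 := Real.add_one_le_exp d
      have a2 : Real.exp (K * d) = Real.exp ((K - 1) * d) * Real.exp d := by
        rw [← Real.exp_add]
        ring_nf
      have a3 : 1 ≤ Real.exp ((K - 1) * d) := Real.one_le_exp (by positivity)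
      rw [a2]
      nlinarith
    have h7 : t * χ y * (Real.exp (K * d) - Real.exp (-((K - 1) * d)))
        ≤ φ y * (Real.exp (K * d) - Real.exp ((K - 1) * d)) := by
      calc t * χ y * (Real.exp (K * d) - Real.exp (-((K - 1) * d)))
          ≤ t * χ y * (Real.exp (K * B) * (2 * K) * d) := by gcongr
        _ ≤ δ * C ^ 2 * φ y * (Real.exp (K * B) * (2 * K) * d) := by gcongr
        _ = δ * (C ^ 2 * (Real.exp (K * B) * (2 * K))) * (φ y * d) := by ring
        _ ≤ 1 * (φ y * d) := by gcongr
        _ = φ y * d := one_mul _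
        _ ≤ _ := by gcongr
    have h8 := mul_le_mul_of_nonneg_left h4 ht0
    linarith

theorem exists_eq_exp {K : ℝ} (hK : 0 ≤ K) {h : HolderSpace M γ ℝ} (hh : holderCone K h)
    (hpos : ∀ x, 0 < h x) : ∃ k : HolderSpace M γ ℝ, h = exp k := by
  lift K to ℝ≥0 using hK
  have hsub : ∀ x y, Real.log (h x) - Real.log (h y) ≤ K * dist x y ^ (γ : ℝ) := fun x y => by
    have h1 := Real.log_le_log (hpos x) (hh.2 x y)
    rw [Real.log_mul (Real.exp_pos _).ne' (hpos y).ne', Real.log_exp] at h1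
    linarith
  refine ⟨ofBound (fun x => Real.log (h x)) (h.continuous.log fun x => (hpos x).ne') K
    fun x y => ?_, ?_⟩
  · change |Real.log (h x) - Real.log (h y)| ≤ K * dist x y ^ (γ : ℝ)
    rw [abs_le]
    have h1 := hsub x y
    have h2 := hsub y x
    rw [dist_comm] at h2
    constructor <;> linarith
  · ext x
    rw [exp_apply, ofBound_apply, Real.exp_log (hpos x)]

end holderCone

variable [MeasurableSpace M] [BorelSpace M] (μ : Measure M) [IsProbabilityMeasure μ]

theorem ruelleOperator_real_apply (f φ : HolderSpace M γ ℝ) (x : ℕ → M) :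
    ruelleOperator ℝ μ f φ x = ∫ a, Real.exp (f (consSeq a x)) * φ (consSeq a x) ∂μ := rfl

theorem ruelle_real_integrable (f φ : HolderSpace M γ ℝ) (x : ℕ → M) :
    Integrable (fun a => Real.exp (f (consSeq a x)) * φ (consSeq a x)) μ :=
  ruelle_integrand_integrable μ f φ x

theorem ruelleOperator_nonneg (f : HolderSpace M γ ℝ) {φ : HolderSpace M γ ℝ}
    (h : ∀ x, 0 ≤ φ x) (x : ℕ → M) : 0 ≤ ruelleOperator ℝ μ f φ x := by
  rw [ruelleOperator_real_apply]
  exact integral_nonneg fun a => mul_nonneg (Real.exp_pos _).le (h _)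

theorem ruelleOperator_pos (f : HolderSpace M γ ℝ) {φ : HolderSpace M γ ℝ}
    (h : ∀ x, 0 < φ x) (x : ℕ → M) : 0 < ruelleOperator ℝ μ f φ x := by
  have hp : ∀ a, 0 < Real.exp (f (consSeq a x)) * φ (consSeq a x) := fun a =>
    mul_pos (Real.exp_pos _) (h _)
  rw [ruelleOperator_real_apply, integral_pos_iff_support_of_nonneg (fun a => (hp a).le)
    (ruelle_real_integrable μ f φ x)]
  have : Function.support (fun a => Real.exp (f (consSeq a x)) * φ (consSeq a x)) = univ :=
    eq_univ_of_forall fun a => (hp a).ne'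
  rw [this, measure_univ]
  exact one_pos

/-- The integrand at `ax` has logarithmic Hölder constant `K + ‖f‖`, and prefixing `a` halves
distances; integration over `a` preserves the pointwise comparison. -/
theorem holderCone.ruelleOperator (f : HolderSpace M γ ℝ) {φ : HolderSpace M γ ℝ} {K : ℝ}
    (h : holderCone K φ) :
    holderCone ((K + ‖f‖) * (1 / 2 : ℝ) ^ (γ : ℝ)) (ruelleOperator ℝ μ f φ) := by
  refine ⟨ruelleOperator_nonneg μ f h.1, fun x y => ?_⟩
  rw [ruelleOperator_real_apply, ruelleOperator_real_apply, ← integral_const_mul]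
  refine integral_mono (ruelle_real_integrable μ f φ x)
    ((ruelle_real_integrable μ f φ y).const_mul _) fun a => ?_
  have h1 := h.2 (consSeq a x) (consSeq a y)
  have h2 := (le_abs_self _).trans (f.norm_sub_le_norm_mul (consSeq a x) (consSeq a y))
  rw [dist_consSeq_rpow] at h1 h2
  have h3 := h.1 (consSeq a y)
  have h4 := h.1 (consSeq a x)
  set D := (1 / 2 : ℝ) ^ (γ : ℝ) * dist x y ^ (γ : ℝ) with hD
  calc Real.exp (f (consSeq a x)) * φ (consSeq a x)
      ≤ Real.exp (‖f‖ * D + f (consSeq a y)) * (Real.exp (K * D) * φ (consSeq a y)) := by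
        gcongr
        linarith
    _ = _ := by
        have e : (K + ‖f‖) * (1 / 2 : ℝ) ^ (γ : ℝ) * dist x y ^ (γ : ℝ)
            = ‖f‖ * D + K * D := by rw [hD]; ring
        rw [e, Real.exp_add, Real.exp_add]
        ring

theorem exists_coneContraction (hγ : 0 < γ) (f : HolderSpace M γ ℝ) (x₀ : ℕ → M) :
    ∃ K C δ : ℝ, 1 ≤ K ∧ ConeContraction (ruelleOperator ℝ μ f) (evalCLM x₀)
      (const M γ (1 : ℝ)) (holderCone K) (holderCone (K - 1)) C 2 δ := by
  obtain ⟨B, hB0, hB⟩ := exists_dist_rpow_le M γ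
  set θ := (1 / 2 : ℝ) ^ (γ : ℝ) with hθ
  have hθ0 : 0 < θ := by positivity
  have hθ1 : θ < 1 := Real.rpow_lt_one (by norm_num) (by norm_num) (by exact_mod_cast hγ)
  have hθ1' : 0 < 1 - θ := by linarith
  -- The solution of `(K + ‖f‖) * θ = K - 1`, which puts the image in the cone with constant `K -
  -- 1`; it exists because `θ < 1`.
  set K := (‖f‖ * θ + 1) / (1 - θ) with hKdef
  have hKeq : (K + ‖f‖) * θ = K - 1 := by
    have : K * (1 - θ) = ‖f‖ * θ + 1 := div_mul_cancel₀ _ hθ1'.ne'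
    linarith
  have hK : 1 ≤ K := by
    rw [hKdef, le_div_iff₀ hθ1']
    nlinarith [norm_nonneg f, mul_nonneg (norm_nonneg f) hθ0.le]
  have hK0 : 0 ≤ K := by linarith
  have hK10 : 0 ≤ K - 1 := by linarith
  set c₁ := Real.exp ((K - 1) * B) ^ 2 with hc₁
  set c₂ := Real.exp (K * B) * (2 * K) with hc₂
  have h1 : 1 ≤ c₁ := one_le_pow₀ (Real.one_le_exp (by positivity))
  have h2 : 2 ≤ c₂ := by
    have : 1 ≤ Real.exp (K * B) := Real.one_le_exp (by positivity)
    rw [hc₂]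
    nlinarith
  have h12 : 0 < c₁ * c₂ := by positivity
  -- The choice `δ = (c₁ * c₂)⁻¹` meets both smallness conditions of `holderCone.sub_smul`; `c₂ ≥ 2`
  -- also makes it less than one.
  have hδ1 : (c₁ * c₂)⁻¹ * (c₁ * c₂) ≤ 1 := (inv_mul_cancel₀ h12.ne').le
  have hδ0 : 0 < (c₁ * c₂)⁻¹ := by positivity
  have hδ2 : (c₁ * c₂)⁻¹ * c₁ ≤ 1 := by
    refine hδ1.trans' ?_
    gcongr
    nlinarith
  refine ⟨K, Real.exp (K * B) + K * Real.exp (K * B) ^ 2, (c₁ * c₂)⁻¹, hK,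
    by positivity, by norm_num, hδ0, ?_, holderCone.const_one hK10, ?_, ?_, ?_, ?_, ?_, ?_, ?_,
    holderCone.isClosed K⟩
  · refine inv_lt_one_of_one_lt₀ ?_
    nlinarith
  · have : ∀ n x, 0 < ((ruelleOperator ℝ μ f) ^ n) (const M γ (1 : ℝ)) x := fun n => by
      induction n with
      | zero => exact fun _ => one_pos
      | succ n ih =>
        rw [pow_succ', mul_apply_eq_comp]
        exact ruelleOperator_pos μ f ih
    exact fun n => this n x₀
  · intro φ hφ
    rw [← hKeq]
    exact hφ.ruelleOperator μ f
  · intro φ χ hφ hχ h0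
    exact holderCone.sub_smul hK hB hδ0.le hδ1 hδ2 hφ hχ h0
  · exact fun φ hφ => hφ.mono (by linarith)
  · exact fun φ hφ => hφ.norm_le hK0 hB x₀
  · exact fun φ => holderCone.add_const hK φ
  · exact fun c φ hc hφ => hφ.smul hc

/-- Ruelle's theorem: the Ruelle operator has a spectral gap, a positive eigenfunctional and a
positive eigenfunction. -/
theorem exists_ruelle_spectralGap (hγ : 0 < γ) (f : HolderSpace M γ ℝ) :
    ∃ (lam : ℝ) (ℓ : HolderSpace M γ ℝ →L[ℝ] ℝ) (k : HolderSpace M γ ℝ),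
      HasSpectralGap (ruelleOperator ℝ μ f) lam ℓ (exp k) ∧
        ∀ φ : HolderSpace M γ ℝ, (∀ x, 0 ≤ φ x) → 0 ≤ ℓ φ := by
  obtain ⟨a⟩ := nonempty_of_isProbabilityMeasure μ
  obtain ⟨K, C, δ, hK, H⟩ := exists_coneContraction μ hγ f fun _ => a
  obtain ⟨lam, ℓ, h, hgap, hP, hlim⟩ := H.exists_hasSpectralGap
  obtain ⟨B, hB0, hB⟩ := exists_dist_rpow_le M γ
  -- On the cone the value at the base point controls the norm, so a zero there would force `h = 0`.
  have h0 : 0 < h fun _ => a := by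
    refine (hP.1 _).lt_of_ne fun h0 => hgap.ne_zero (norm_le_zero_iff.1 ?_)
    refine (H.norm_le h hP).trans ?_
    rw [evalCLM_apply, ← h0, mul_zero]
  have hpos : ∀ x, 0 < h x := fun x =>
    pos_of_mul_pos_right (h0.trans_le (hP.le_exp_mul (by linarith) hB _ x)) (Real.exp_pos _).le
  obtain ⟨k, rfl⟩ := hP.exists_eq_exp (by linarith) hpos
  refine ⟨lam, ℓ, k, hgap, fun φ hφ => ge_of_tendsto' (hlim φ) fun n => ?_⟩
  refine div_nonneg ?_ (H.orbit_pos n).le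
  have : ∀ x, 0 ≤ ((ruelleOperator ℝ μ f) ^ n) φ x := by
    induction n with
    | zero => exact hφ
    | succ n ih =>
      rw [pow_succ', mul_apply_eq_comp]
      exact ruelleOperator_nonneg μ f ih
  exact this _

theorem ruelleOperator_toComplex (f φ : HolderSpace M γ ℝ) :
    ruelleOperator ℂ μ f (toComplex φ) = toComplex (ruelleOperator ℝ μ f φ) := by
  ext x
  rw [ruelleOperator_apply, toComplex_apply, ruelleOperator_real_apply, ← integral_complex_ofReal]
  refine integral_congr_ae (ae_of_all _ fun a => ?_)
  simp

theorem isMainEigenvalue_of_hasSpectralGap {f : HolderSpace M γ ℝ} {lam : ℝ}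
    {ℓ : HolderSpace M γ ℝ →L[ℝ] ℝ} {h : HolderSpace M γ ℝ}
    (H : HasSpectralGap (ruelleOperator ℝ μ f) lam ℓ h) :
    IsMainEigenvalue (ruelleOperator ℂ μ f) lam :=
  (H.complexify (ruelleOperator_toComplex μ f)).isMainEigenvalue

theorem mainEigenvalue_isMainEigenvalue (hγ : 0 < γ) (f : HolderSpace M γ ℝ) :
    IsMainEigenvalue (ruelleOperator ℂ μ f) (mainEigenvalue μ f) := by
  obtain ⟨lam, ℓ, k, H, -⟩ := exists_ruelle_spectralGap μ hγ f
  have hex : ∃ t : ℝ, IsMainEigenvalue (ruelleOperator ℂ μ f) t :=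
    ⟨lam, isMainEigenvalue_of_hasSpectralGap μ H⟩
  rw [mainEigenvalue, dif_pos hex]
  exact hex.choose_spec

theorem exists_mainEigenvalue_spectralGap (hγ : 0 < γ) (f : HolderSpace M γ ℝ) :
    ∃ (ℓ : HolderSpace M γ ℝ →L[ℝ] ℝ) (k : HolderSpace M γ ℝ),
      HasSpectralGap (ruelleOperator ℝ μ f) (mainEigenvalue μ f) ℓ (exp k) ∧
        ∀ φ : HolderSpace M γ ℝ, (∀ x, 0 ≤ φ x) → 0 ≤ ℓ φ := by
  obtain ⟨lam, ℓ, k, H, hpos⟩ := exists_ruelle_spectralGap μ hγ f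
  obtain rfl := (isMainEigenvalue_of_hasSpectralGap μ H).unique
    (mainEigenvalue_isMainEigenvalue μ hγ f)
  exact ⟨ℓ, k, H, hpos⟩

end RuelleCone

/-! ### Equilibrium states and the variational principle. -/

noncomputable section EquilibriumState

open HolderSpace

variable {M : Type*} [MetricSpace M] [CompactSpace M] {γ : ℝ≥0}

theorem dist_shiftSeq_le (x y : ℕ → M) : dist (shiftSeq x) (shiftSeq y) ≤ 2 * dist x y := by
  have h : dist x y = (1 / 2 : ℝ) ^ (0 + 1) * dist (x 0) (y 0)
      + (1 / 2 : ℝ) * dist (shiftSeq x) (shiftSeq y) := by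
    change (∑' n : ℕ, (1 / 2 : ℝ) ^ (n + 1) * dist (x n) (y n)) = _
      + (1 / 2 : ℝ) * ∑' n : ℕ, (1 / 2 : ℝ) ^ (n + 1) * dist (x (n + 1)) (y (n + 1))
    rw [(seqDist_summable x y).tsum_eq_zero_add, ← tsum_mul_left]
    congr 1
    exact tsum_congr fun n => by ring
  have := dist_nonneg (x := x 0) (y := y 0)
  rw [h]
  linarith

theorem continuous_shiftSeq {X : Type*} [TopologicalSpace X] :
    Continuous (shiftSeq : (ℕ → X) → (ℕ → X)) :=
  continuous_pi fun n => continuous_apply (n + 1)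

namespace HolderSpace

/-- Composition with the shift. -/
def compShift (φ : HolderSpace M γ ℝ) : HolderSpace M γ ℝ :=
  ofBound (fun x => φ (shiftSeq x)) (φ.continuous.comp continuous_shiftSeq)
    (nnHolderNorm γ φ * 2 ^ (γ : ℝ)) fun x y => by
      refine (φ.norm_sub_le _ _).trans ?_
      rw [NNReal.coe_mul, mul_assoc, NNReal.coe_rpow, NNReal.coe_ofNat,
        ← Real.mul_rpow zero_le_two dist_nonneg]
      gcongr
      exact dist_shiftSeq_le x y

@[simp] theorem compShift_apply (φ : HolderSpace M γ ℝ) (x : ℕ → M) :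
    compShift φ x = φ (shiftSeq x) := rfl

end HolderSpace

/-- A normalized positive functional on Hölder functions is integration against a probability
measure. -/
theorem exists_measure_of_positive_functional [MeasurableSpace M] [BorelSpace M]
    (m : HolderSpace M γ ℝ →L[ℝ] ℝ) (hm : ∀ φ : HolderSpace M γ ℝ, (∀ x, 0 ≤ φ x) → 0 ≤ m φ)
    (hm1 : m (const M γ (1 : ℝ)) = 1) :
    ∃ ν : Measure (ℕ → M), IsProbabilityMeasure ν ∧
      ∀ φ : HolderSpace M γ ℝ, ∫ x, φ x ∂ν = m φ := by
  -- Positivity upgrades continuity to the supremum norm, as needed to extend `m` to all continuous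
  -- functions by Hahn–Banach.
  have hbound : ∀ φ : HolderSpace M γ ℝ, |m φ| ≤ ‖φ.toCont‖ := fun φ => by
    have hb : ∀ x, |φ x| ≤ ‖φ.toCont‖ := fun x => φ.norm_apply_le x
    have h1 := hm (‖φ.toCont‖ • const M γ (1 : ℝ) - φ) fun x => by
      have := (abs_le.1 (hb x)).2
      simp only [sub_apply', smul_apply', const_apply]
      linarith
    have h2 := hm (‖φ.toCont‖ • const M γ (1 : ℝ) + φ) fun x => by
      have := (abs_le.1 (hb x)).1
      simp only [add_apply', smul_apply', const_apply]
      linarith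
    rw [map_sub, map_smul, hm1, smul_eq_mul] at h1
    rw [map_add, map_smul, hm1, smul_eq_mul] at h2
    rw [abs_le]
    constructor <;> linarith
  let m₀ : ↥(holderSubmodule M γ ℝ) →L[ℝ] ℝ :=
    LinearMap.mkContinuous
      ⟨⟨fun φ => m (show HolderSpace M γ ℝ from φ), fun φ ψ => m.map_add _ _⟩,
        fun c φ => m.map_smul c _⟩ 1 fun φ => by
        rw [one_mul]
        exact hbound (show HolderSpace M γ ℝ from φ)
  have hm₀ : ‖m₀‖ ≤ 1 := LinearMap.mkContinuous_norm_le _ zero_le_one _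
  obtain ⟨g, hg, hgn⟩ := exists_extension_norm_eq (holderSubmodule M γ ℝ) m₀
  have hgm : ∀ φ : HolderSpace M γ ℝ, g φ.toCont = m φ := fun φ => hg φ
  have hg1 : g 1 = 1 := (hgm (const M γ (1 : ℝ))).trans hm1
  -- An extension of norm at most one with `g 1 = 1` is positive: for `F ≥ 0`, `‖F‖ • 1 - F` has
  -- norm at most `‖F‖`, so `‖F‖ - g F ≤ ‖F‖`.
  have hgpos : ∀ F : C(ℕ → M, ℝ), 0 ≤ F → 0 ≤ g F := fun F hF => by
    have h1 : ‖‖F‖ • (1 : C(ℕ → M, ℝ)) - F‖ ≤ ‖F‖ := by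
      refine (ContinuousMap.norm_le _ (norm_nonneg F)).2 fun x => ?_
      have h2 : 0 ≤ F x := hF x
      have h3 : F x ≤ ‖F‖ := (le_abs_self _).trans (F.norm_coe_le_norm x)
      change |‖F‖ * 1 - F x| ≤ ‖F‖
      rw [abs_le]
      constructor <;> linarith
    have h2 := (le_abs_self _).trans (g.le_opNorm (‖F‖ • (1 : C(ℕ → M, ℝ)) - F))
    rw [map_sub, map_smul, hg1, smul_eq_mul, mul_one, hgn] at h2
    have h3 : ‖m₀‖ * ‖‖F‖ • (1 : C(ℕ → M, ℝ)) - F‖ ≤ 1 * ‖F‖ := by gcongr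
    linarith
  let Λ : CompactlySupportedContinuousMap (ℕ → M) ℝ →ₚ[ℝ] ℝ := PositiveLinearMap.mk₀
    { toFun := fun F => g F.toContinuousMap
      map_add' := fun F G => g.map_add _ _
      map_smul' := fun c F => g.map_smul c _ } fun F hF => hgpos _ hF
  have hint : ∀ F : C(ℕ → M, ℝ), ∫ x, F x ∂(RealRMK.rieszMeasure Λ) = g F := fun F =>
    RealRMK.integral_rieszMeasure Λ
      ⟨F, HasCompactSupport.of_compactSpace F⟩
  refine ⟨RealRMK.rieszMeasure Λ, ⟨?_⟩, fun φ => (hint φ.toCont).trans (hgm φ)⟩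
  have h1 := hint 1
  rw [hg1] at h1
  simp only [ContinuousMap.one_apply, integral_const, smul_eq_mul, mul_one] at h1
  exact (ENNReal.toReal_eq_one_iff _).1 h1

/-- Probability measures on `Ω` are determined by the integrals of Hölder functions. -/
theorem measure_ext_of_holder [MeasurableSpace M] [BorelSpace M] (hγ1 : γ ≤ 1)
    {ν ν' : Measure (ℕ → M)} [IsProbabilityMeasure ν] [IsProbabilityMeasure ν']
    (h : ∀ φ : HolderSpace M γ ℝ, ∫ x, φ x ∂ν = ∫ x, φ x ∂ν') : ν = ν' := by
  let p : ProbabilityMeasure (ℕ → M) := ⟨ν, inferInstance⟩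
  let p' : ProbabilityMeasure (ℕ → M) := ⟨ν', inferInstance⟩
  -- Weak convergence is tested by bounded Lipschitz functions, which are `γ`-Hölder as `γ ≤ 1` and
  -- `Ω` is bounded. The constant sequence at `ν` thus also converges to `ν'`, and weak limits are
  -- unique.
  have hlim : Tendsto (fun _ : ℕ => p) atTop (𝓝 p') := by
    rw [tendsto_iff_forall_lipschitz_integral_tendsto]
    rintro f - ⟨L, hL⟩
    have hmem : MemHolder γ f := (holderWith_one.2 hL).memHolder.of_le hγ1
    let φ : HolderSpace M γ ℝ :=
      (⟨⟨f, hL.continuous⟩, hmem⟩ : ↥(holderSubmodule M γ ℝ))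
    refine tendsto_const_nhds.congr fun _ => ?_
    exact (h φ).symm
  have : p = p' := tendsto_nhds_unique tendsto_const_nhds hlim
  exact congrArg Subtype.val this

variable [MeasurableSpace M] [BorelSpace M] (μ : Measure M) [IsProbabilityMeasure μ]

/-- Since `compShift φ` takes the value `φ x` at every `ax`, it leaves the integral, and `𝓛_f (e^k
(φ ∘ σ)) = lam e^k φ`; applying `ℓ` and cancelling `lam` gives invariance. -/
theorem HasSpectralGap.functional_mulExp_compShift {f k : HolderSpace M γ ℝ} {lam : ℝ}
    {ℓ : HolderSpace M γ ℝ →L[ℝ] ℝ} (H : HasSpectralGap (ruelleOperator ℝ μ f) lam ℓ (exp k))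
    (φ : HolderSpace M γ ℝ) : ℓ (mulExp k (compShift φ)) = ℓ (mulExp k φ) := by
  have h1 : ruelleOperator ℝ μ f (mulExp k (compShift φ)) = lam • mulExp k φ := by
    ext x
    have h2 := DFunLike.congr_fun H.map_eigenvector x
    rw [ruelleOperator_real_apply] at h2 ⊢
    have h3 : ∀ a, Real.exp (f (consSeq a x)) * mulExp k (compShift φ) (consSeq a x)
        = Real.exp (f (consSeq a x)) * exp k (consSeq a x) * φ x := fun a => by
      rw [mulExp_apply, exp_apply, compShift_apply, mul_assoc]
      rfl
    simp_rw [h3]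
    rw [integral_mul_const, h2]
    change lam * exp k x * φ x = lam * mulExp k φ x
    rw [mulExp_apply, exp_apply, mul_assoc]
  have h2 := H.map_functional (mulExp k (compShift φ))
  rw [h1, map_smul, smul_eq_mul] at h2
  exact (mul_left_cancel₀ H.pos.ne' h2).symm

/-- The equilibrium state of `f`. -/
theorem exists_equilibriumState (hγ1 : γ ≤ 1) {f k : HolderSpace M γ ℝ} {lam : ℝ}
    {ℓ : HolderSpace M γ ℝ →L[ℝ] ℝ} (H : HasSpectralGap (ruelleOperator ℝ μ f) lam ℓ (exp k))
    (hℓ : ∀ φ : HolderSpace M γ ℝ, (∀ x, 0 ≤ φ x) → 0 ≤ ℓ φ) :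
    ∃ ν : Measure (ℕ → M), IsProbabilityMeasure ν ∧ MeasurePreserving shiftSeq ν ν ∧
      ∀ φ : HolderSpace M γ ℝ, ∫ x, φ x ∂ν = ℓ (mulExp k φ) := by
  obtain ⟨ν, hν, hint⟩ := exists_measure_of_positive_functional (ℓ ∘L mulExp k)
    (fun φ hφ => hℓ (mulExp k φ) fun x => by
      rw [mulExp_apply]
      exact mul_nonneg (Real.exp_pos _).le (hφ x)) H.normalized
  have hmeas : Measurable (shiftSeq : (ℕ → M) → (ℕ → M)) :=
    measurable_pi_lambda _ fun n => measurable_pi_apply (n + 1)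
  refine ⟨ν, hν, ⟨hmeas, ?_⟩, hint⟩
  have hmap : IsProbabilityMeasure (ν.map shiftSeq) :=
    Measure.isProbabilityMeasure_map hmeas.aemeasurable
  refine measure_ext_of_holder hγ1 fun φ => ?_
  rw [integral_map hmeas.aemeasurable φ.continuous.aestronglyMeasurable, hint]
  exact (hint (compShift φ)).trans (H.functional_mulExp_compShift μ φ)

/-- The functional `φ ↦ ℓ (exp k * φ)` is a subgradient of the logarithm of the eigenvalue. -/
theorem HasSpectralGap.log_add_functional_le {f k g k' : HolderSpace M γ ℝ} {lam lam' : ℝ}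
    {ℓ ℓ' : HolderSpace M γ ℝ →L[ℝ] ℝ} (H : HasSpectralGap (ruelleOperator ℝ μ f) lam ℓ (exp k))
    (hℓ : ∀ φ : HolderSpace M γ ℝ, (∀ x, 0 ≤ φ x) → 0 ≤ ℓ φ)
    (H' : HasSpectralGap (ruelleOperator ℝ μ g) lam' ℓ' (exp k')) :
    Real.log lam + ℓ (mulExp k (g - f)) ≤ Real.log lam' := by
  -- The coboundary turns the eigenfunction equation of `g` into `𝓛_f (e^k e^v) = lam' e^k`, and
  -- invariance makes it invisible to `ℓ (e^k ·)`. So `lam * ℓ (e^k e^v) = lam'` while the mean of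
  -- `v` is `c`.
  set v := (g - f) + (k' - k) - compShift (k' - k) with hv
  set c := ℓ (mulExp k (g - f)) with hc
  have hvc : ℓ (mulExp k v) = c := by
    rw [hv, map_sub, map_sub, map_add, map_add, H.functional_mulExp_compShift μ, hc]
    ring
  have h1 : ruelleOperator ℝ μ f (mulExp k (exp v)) = lam' • exp k := by
    ext x
    have h2 := DFunLike.congr_fun H'.map_eigenvector x
    rw [ruelleOperator_real_apply] at h2 ⊢
    have h3 : ∀ a, Real.exp (f (consSeq a x)) * mulExp k (exp v) (consSeq a x)
        = Real.exp (g (consSeq a x)) * exp k' (consSeq a x) * Real.exp (k x - k' x) := fun a => by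
      have h4 : v (consSeq a x) = (g (consSeq a x) - f (consSeq a x))
          + (k' (consSeq a x) - k (consSeq a x)) - (k' x - k x) := rfl
      rw [mulExp_apply, exp_apply, exp_apply, h4, ← Real.exp_add, ← Real.exp_add, ← Real.exp_add,
        ← Real.exp_add]
      congr 1
      ring
    simp_rw [h3]
    rw [integral_mul_const, h2]
    change lam' * exp k' x * Real.exp (k x - k' x) = lam' * exp k x
    rw [exp_apply, exp_apply, mul_assoc, ← Real.exp_add, add_sub_cancel]
  have h2 : lam * ℓ (mulExp k (exp v)) = lam' := by
    have := H.map_functional (mulExp k (exp v))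
    rw [h1, map_smul, H.normalized, smul_eq_mul, mul_one] at this
    exact this.symm
  -- Jensen's inequality through the tangent line of `exp` at `c`: `e^v ≥ e^c (1 + v - c)`,
  -- integrated against the equilibrium state.
  have h3 := hℓ (mulExp k (exp v - Real.exp c • (const M γ (1 : ℝ) + (v - c • const M γ (1 : ℝ)))))
    fun x => by
      rw [mulExp_apply]
      refine mul_nonneg (Real.exp_pos _).le ?_
      simp only [sub_apply', smul_apply', add_apply', const_apply, exp_apply]
      have e1 := Real.add_one_le_exp (v x - c)
      have e2 : Real.exp (v x) = Real.exp c * Real.exp (v x - c) := by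
        rw [← Real.exp_add, add_sub_cancel]
      rw [e2, ← mul_sub]
      refine mul_nonneg (Real.exp_pos _).le ?_
      linarith
  have h4 : ℓ (mulExp k (const M γ (1 : ℝ))) = 1 := H.normalized
  simp only [map_sub, map_add, map_smul, hvc, h4, smul_eq_mul] at h3
  have h5 : Real.exp c ≤ ℓ (mulExp k (exp v)) := by linarith
  have h6 : lam * Real.exp c ≤ lam' := by
    rw [← h2]
    exact mul_le_mul_of_nonneg_left h5 H.pos.le
  have h7 := Real.log_le_log (mul_pos H.pos (Real.exp_pos c)) h6
  rwa [Real.log_mul H.pos.ne' (Real.exp_pos c).ne', Real.log_exp] at h7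

/-- The variational principle. -/
theorem pressure_eq_log_mainEigenvalue (hγ0 : 0 < γ) (hγ1 : γ ≤ 1) (f : HolderSpace M γ ℝ) :
    pressure μ f = ((Real.log (mainEigenvalue μ f) : ℝ) : EReal) := by
  apply le_antisymm
  · refine iSup_le fun ν => iSup_le fun _ => iSup_le fun _ => ?_
    refine (add_le_add_left (iInf_le _ f) _).trans_eq ?_
    rw [← EReal.coe_add]
    congr 1
    ring
  · obtain ⟨ℓ, k, H, hℓ⟩ := exists_mainEigenvalue_spectralGap μ hγ0 f
    obtain ⟨ν, hν, hinv, hint⟩ := exists_equilibriumState μ hγ1 H hℓ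
    refine le_trans ?_ (le_iSup_of_le ν (le_iSup_of_le hν (le_iSup_of_le hinv le_rfl)))
    have hent : ((Real.log (mainEigenvalue μ f) - ∫ x, f x ∂ν : ℝ) : EReal) ≤ entropyOf γ μ ν := by
      refine le_iInf fun g => EReal.coe_le_coe_iff.2 ?_
      obtain ⟨ℓ', k', H', -⟩ := exists_mainEigenvalue_spectralGap μ hγ0 g
      have := H.log_add_functional_le μ hℓ H'
      rw [map_sub, map_sub] at this
      rw [hint, hint]
      linarith
    refine (add_le_add_left hent _).trans_eq' ?_
    rw [← EReal.coe_add, sub_add_cancel]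

end EquilibriumState

/-! ### Analyticity of the main eigenvalue. -/

section PressureAnalytic

open HolderSpace

variable {M : Type*} [MetricSpace M] [CompactSpace M] {γ : ℝ≥0}

/-- By compactness `φ ≥ c • exp k` for some `c > 0`, so `ℓ φ ≥ c`. -/
theorem functional_pos_of_pos [Nonempty M] {ℓ : HolderSpace M γ ℝ →L[ℝ] ℝ}
    {k : HolderSpace M γ ℝ} (hk : ℓ (exp k) = 1)
    (hℓ : ∀ φ : HolderSpace M γ ℝ, (∀ x, 0 ≤ φ x) → 0 ≤ ℓ φ)
    {φ : HolderSpace M γ ℝ} (hφ : ∀ x, 0 < φ x) : 0 < ℓ φ := by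
  obtain ⟨x₀, -, hx₀⟩ := isCompact_univ.exists_isMinOn univ_nonempty
    ((Real.continuous_exp.comp k.continuous.neg).mul φ.continuous).continuousOn
  set c := Real.exp (-(k x₀)) * φ x₀ with hc
  have hcpos : 0 < c := mul_pos (Real.exp_pos _) (hφ x₀)
  have h1 := hℓ (φ - c • exp k) fun x => by
    have h2 : c ≤ Real.exp (-(k x)) * φ x := hx₀ (mem_univ x)
    have h3 := mul_le_mul_of_nonneg_right h2 (Real.exp_pos (k x)).le
    rw [mul_right_comm (Real.exp (-(k x))), ← Real.exp_add, neg_add_cancel, Real.exp_zero, one_mul] at h3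
    simpa using h3
  rw [map_sub, map_smul, hk, smul_eq_mul, mul_one] at h1
  linarith

theorem eventually_forall_pos [Nonempty M] {φ : HolderSpace M γ ℝ} (hφ : ∀ x, 0 < φ x) :
    ∀ᶠ ψ in 𝓝 φ, ∀ x, 0 < ψ x := by
  obtain ⟨x₀, -, hx₀⟩ := isCompact_univ.exists_isMinOn univ_nonempty φ.continuous.continuousOn
  filter_upwards [Metric.ball_mem_nhds φ (hφ x₀)] with ψ hψ x
  rw [Metric.mem_ball, dist_eq_norm] at hψ
  have h1 : φ x₀ ≤ φ x := hx₀ (mem_univ x)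
  have h2 : |ψ x - φ x| ≤ ‖ψ - φ‖ := (ψ - φ).norm_coe_le x
  have h3 := (abs_le.1 h2).1
  linarith

variable [MeasurableSpace M] [BorelSpace M] (μ : Measure M) [IsProbabilityMeasure μ]

theorem ruelleOperator_eq_comp_mulExp (f : HolderSpace M γ ℝ) :
    ruelleOperator ℝ μ f = ruelleOperator ℝ μ 0 ∘L mulExp f := by
  ext φ x
  rw [ContinuousLinearMap.comp_apply, ruelleOperator_real_apply, ruelleOperator_real_apply]
  refine integral_congr_ae (ae_of_all _ fun a => ?_)
  simp

theorem analyticAt_ruelleOperator (f : HolderSpace M γ ℝ) :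
    AnalyticAt ℝ (fun f : HolderSpace M γ ℝ => ruelleOperator ℝ μ f) f := by
  have h : (fun f : HolderSpace M γ ℝ => ruelleOperator ℝ μ f)
      = fun f => ContinuousLinearMap.compL ℝ _ _ _ (ruelleOperator ℝ μ 0) (mulExp f) :=
    funext fun f => ruelleOperator_eq_comp_mulExp μ f
  rw [h]
  exact (ContinuousLinearMap.analyticAt _ _).comp (analyticAt_mulExp f)

/-- The continued eigenvalue is the main one: the continued eigenvector `w g` is positive for `g`
near `f`, so the eigenfunctional of `𝓛_g` does not vanish on it, and evaluating it on `𝓛_g (w g)` in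
two ways equates the eigenvalues. -/
theorem analyticAt_mainEigenvalue (hγ : 0 < γ) (f : HolderSpace M γ ℝ) :
    AnalyticAt ℝ (fun f : HolderSpace M γ ℝ => mainEigenvalue μ f) f := by
  have hM : Nonempty M := nonempty_of_isProbabilityMeasure μ
  obtain ⟨ℓ, k, H, -⟩ := exists_mainEigenvalue_spectralGap μ hγ f
  have hA := analyticAt_ruelleOperator μ f
  obtain ⟨w, hw, hwf, heq⟩ := HasSpectralGap.exists_analyticAt_eigenvector
    (A := fun f : HolderSpace M γ ℝ => ruelleOperator ℝ μ f) H hA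
  have han : AnalyticAt ℝ (fun g => ℓ (ruelleOperator ℝ μ g (w g))) f :=
    (ℓ.analyticAt _).comp ((ContinuousLinearMap.id ℝ
      (HolderSpace M γ ℝ →L[ℝ] HolderSpace M γ ℝ)).analyticAt_bilinear _ |>.comp (hA.prod hw))
  refine han.congr ?_
  have hpos : ∀ᶠ g in 𝓝 f, ∀ x, 0 < w g x := by
    have h := hw.continuousAt
    rw [ContinuousAt, hwf] at h
    exact h.eventually (eventually_forall_pos fun x => by
      rw [exp_apply]
      exact Real.exp_pos _)
  filter_upwards [heq, hpos] with g hg hgpos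
  obtain ⟨ℓ', k', H', hℓ'⟩ := exists_mainEigenvalue_spectralGap μ hγ g
  have h1 := H'.map_functional (w g)
  rw [hg, map_smul, smul_eq_mul] at h1
  exact mul_right_cancel₀ (functional_pos_of_pos H'.normalized hℓ' hgpos).ne' h1

end PressureAnalytic

theorem theorem5 {M : Type*} [MetricSpace M] [CompactSpace M] [MeasurableSpace M] [BorelSpace M]
    (μ : Measure M) [IsProbabilityMeasure μ] [μ.IsOpenPosMeasure]
    (γ : ℝ≥0) (hγ0 : 0 < γ) (hγ1 : γ ≤ 1) :
    (∀ f : HolderSpace M γ ℝ,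
      IsMainEigenvalue (ruelleOperator ℂ μ f) (mainEigenvalue μ f) ∧
        pressure μ f = ((Real.log (mainEigenvalue μ f) : ℝ) : EReal)) ∧
      AnalyticOnNhd ℝ (fun f : HolderSpace M γ ℝ => (pressure μ f).toReal) univ := by
  refine ⟨fun f => ⟨mainEigenvalue_isMainEigenvalue μ hγ0 f,
    pressure_eq_log_mainEigenvalue μ hγ0 hγ1 f⟩, fun f _ => ?_⟩
  have h : (fun f : HolderSpace M γ ℝ => (pressure μ f).toReal)
      = fun f => Real.log (mainEigenvalue μ f) := funext fun f => by
    rw [pressure_eq_log_mainEigenvalue μ hγ0 hγ1 f, EReal.toReal_coe]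
  rw [h]
  have hpos : 0 < mainEigenvalue μ f := (mainEigenvalue_isMainEigenvalue μ hγ0 f).1
  exact AnalyticAt.comp (g := Real.log) (f := fun f : HolderSpace M γ ℝ => mainEigenvalue μ f)
    (analyticAt_log hpos) (analyticAt_mainEigenvalue μ hγ0 f)
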